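/- Let $1\le k<n$, let $W=S_n$ with simple transpositions $s_i=(i\;i{+}1)$ and length function $\ell$ (number of inversions), let $W_K=\langle s_i: i\ne k\rangle$ and let $w_K$ be its longest element. For a $k$-subset $I\subseteq[n]$ let $\lambda_I$ be the Young diagram in the $k\times(n-k)$ rectangle cut out (in the northwest corner) by the lattice path from the southwest to the northeast corner whose north steps are the steps with labels in $I$; conversely $V(\mu)$ denotes the set of labels of the north steps of the path of $\mu$, so that $V(\emptyset)=[k]$. Let $x$ be a minimal-length representative of its coset $xW_K$, let $w=xw_K$ with $\ell(w)=\ell(x)+\ell(w_K)$, and let $\lambda=\lambda_{x([k])}$. Fill the box in row $r$ and column $c$ of $\lambda$ with $s_{k-r+c}$ and read the columns from top to bottom, from left to right, to obtain $s_{i_1},s_{i_2},\dots,s_{i_m}$; then $x=s_{i_m}\cdots s_{i_1}$ is the columnar expression of $x$. The bridge graph $B=B_{w_K,\mathbf w}$, a bipartite planar graph in a disk with boundary vertices $1,\dots,n$ in clockwise order, arises from the graph with white lollipops at $1,\dots,k$ and black lollipops at $k+1,\dots,n$ by adding bridges $s_{i_1},\dots,s_{i_m}$ in this order: for $s_j$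 one puts a white vertex on the edge at $j$ and a black vertex on the edge at $j+1$ (or uses the lollipop there, if it has this colour), joins them by an edge, and adds vertices of degree two if needed to keep the graph bipartite. Trips turn maximally left at white and maximally right at black vertices; the (target) label of a face is the set of all $j$ such that the face is to the left of the trip ending at $j$, where a $j$ with a white lollipop is in all labels and a $j$ with a black lollipop is in none. The vertices of the dual quiver of $B$ are the faces, those on the boundary of the disk being frozen; every edge between two faces that are not both frozen gives an arrow across it, with the white endpoint on the left and the black one on the right, and then oriented 2-cycles are removed one by one. Then distinct faces of $B$ have distinct labels, the labels are exactly $[k]$ and the sets $V(\mu)$ for the non-empty rectangles $\mu\subseteq\lambda$, and the following holds. (a) For non-empty rectangles $\mu,\nu\subseteq\lambda$, the dual quiver has exactly one arrow from the face labeled $V(\mu)$ to the face labeled $V(\nu)$ if at least one of these faces is not on the boundary and $\nu$ is obtained from $\mu$ by removing a row or a column, or by adding a hook (that is, a new last row together with a new last column); otherwise there is no arrow from the first to the second. (b) There is exactly one arrow from the face labeled $V(\square)$ of the single box to the face labeled $[k]$ if the face labeled $V(\square)$ is not on the boundary; there are no other arrows between the face labeled $[k]$ and the faces labeled by non-empty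 rectangles, in either direction. (So arrows between two boundary faces are always omitted.) (c) Let $v$ be a maximal-length representative of its coset $W_Kv$ with $\ell(xv)=\ell(x)+\ell(v)$ (for example $v=w_K$). Let $Q_{v,xv}$ be the quiver with one vertex in every box of $\lambda$, where a box is frozen if its southeast neighbour is not in $\lambda$, with one arrow from every box to the box directly above it and to the box directly to its left, and from the upper left to the lower right box of every $2\times2$ square in $\lambda$, but with the arrows between two frozen vertices removed. Sending a box $b$ to the face labeled $V(\mathrm{Rect}(b))$, where $\mathrm{Rect}(b)$ is the largest rectangle with lower right corner $b$, is an isomorphism, preserving frozen vertices, from $Q_{v,xv}$ to the dual quiver of $B$ with the vertex labeled $[k]$ removed. -/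

import Mathlib

/-! ### Permutations of `[n]` (indexed by `Fin n`: the element `i` of `[n]` is `i - 1` here) -/

/-- The Coxeter length of a permutation: its number of inversions. -/
def permLength {n : ℕ} (w : Equiv.Perm (Fin n)) : ℕ :=
  (Finset.univ.filter fun p : Fin n × Fin n => p.1 < p.2 ∧ w p.2 < w p.1).card

/-- The parabolic subgroup `W_K` of `S_n`, generated by all the simple transpositions
`s_j = (j  j+1)` with `j ≠ k` (here `j = i + 1`). -/
def parabolicSubgroup (n k : ℕ) : Subgroup (Equiv.Perm (Fin n)) :=
  Subgroup.closure {s | ∃ (i : ℕ) (h : i + 1 < n), i + 1 ≠ k ∧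
    s = Equiv.swap ⟨i, Nat.lt_of_succ_lt h⟩ ⟨i + 1, h⟩}

/-- `x` is a minimal-length representative of its coset `x W_K`. -/
def IsMinLeftCosetRep {n : ℕ} (k : ℕ) (x : Equiv.Perm (Fin n)) : Prop :=
  ∀ u ∈ parabolicSubgroup n k, permLength x ≤ permLength (x * u)

/-- `v` is a maximal-length representative of its coset `W_K v`. -/
def IsMaxRightCosetRep {n : ℕ} (k : ℕ) (v : Equiv.Perm (Fin n)) : Prop :=
  ∀ u ∈ parabolicSubgroup n k, permLength (u * v) ≤ permLength v

/-- `wK` is the longest element of `W_K`. -/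
def IsLongestInParabolic {n : ℕ} (k : ℕ) (wK : Equiv.Perm (Fin n)) : Prop :=
  wK ∈ parabolicSubgroup n k ∧ ∀ u ∈ parabolicSubgroup n k, permLength u ≤ permLength wK

/-- The subset `[k]` of `[n]`. -/
def initialSubset (n k : ℕ) : Finset (Fin n) := Finset.univ.filter fun i => (i : ℕ) < k

/-! ### Young diagrams and lattice paths -/

/-- The labels of the north steps of the lattice path which goes north and east from the
southwest to the northeast corner of the `k × (n - k)` rectangle and cuts out `μ` in its northwest
corner.  The north step along row `r` (rows are numbered `0, …, k - 1` from the top) comes after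
`k - 1 - r` north steps and `μ.rowLen r` east steps. -/
def verticalSteps (n k : ℕ) (μ : YoungDiagram) : Finset (Fin n) :=
  Finset.univ.filter fun i => ∃ r ∈ Finset.range k, (i : ℕ) = (k - 1 - r) + μ.rowLen r

/-- The Young diagram cut out by the lattice path, from southwest to northeast, whose north steps
are the elements of `I`.  Its row `r` (from the top) has one box for every east step `j` which is
followed by more than `r` north steps. -/
def diagramOfSteps {n : ℕ} (I : Finset (Fin n)) : YoungDiagram where
  cells := (Finset.range n ×ˢ Finset.range n).filter fun b =>
    b.2 < (Finset.univ.filter fun j => j ∉ I ∧ b.1 < (I.filter fun i => j < i).card).card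
  isLowerSet := by
    rintro ⟨r, c⟩ ⟨r', c'⟩ hle h
    obtain ⟨hr, hc⟩ : r' ≤ r ∧ c' ≤ c := hle
    simp only [Finset.coe_filter, Finset.mem_product, Finset.mem_range, Set.mem_ofPred_eq] at h ⊢
    refine ⟨⟨by omega, by omega⟩, lt_of_le_of_lt hc (lt_of_lt_of_le h.2 (Finset.card_le_card ?_))⟩
    intro j hj
    simp only [Finset.mem_filter, Finset.mem_univ, true_and] at hj ⊢
    exact ⟨hj.1, lt_of_le_of_lt hr hj.2⟩

/-- The rectangular Young diagram with `r` rows and `c` columns. -/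
def rectDiagram (r c : ℕ) : YoungDiagram where
  cells := Finset.range r ×ˢ Finset.range c
  isLowerSet := by
    rintro ⟨a, b⟩ ⟨a', b'⟩ hle h
    obtain ⟨h1, h2⟩ : a' ≤ a ∧ b' ≤ b := hle
    simp only [Finset.coe_product, Finset.coe_range, Set.mem_prod, Set.mem_Iio] at h ⊢
    omega

/-- `μ` is a rectangle, not the empty one. -/
def IsNonemptyRect (μ : YoungDiagram) : Prop :=
  ∃ r c : ℕ, 0 < r ∧ 0 < c ∧ μ = rectDiagram r c

/-- The rectangle `ν` is obtained from the rectangle `μ` by removing a row or a column. -/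
def RemovesRowOrColumn (μ ν : YoungDiagram) : Prop :=
  ∃ r c : ℕ, 0 < r ∧ 0 < c ∧ ν = rectDiagram r c ∧
    (μ = rectDiagram (r + 1) c ∨ μ = rectDiagram r (c + 1))

/-- The rectangle `ν` is obtained from the rectangle `μ` by adding a hook shape (a new last row
together with a new last column). -/
def AddsHook (μ ν : YoungDiagram) : Prop :=
  ∃ r c : ℕ, 0 < r ∧ 0 < c ∧ μ = rectDiagram r c ∧ ν = rectDiagram (r + 1) (c + 1)

/-- `Rect(b)`, the largest rectangle with lower right corner `b` (it lies in every Young diagram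
that contains the box `b = (row, column)`, both numbered from `0`). -/
def rectOfBox (b : ℕ × ℕ) : YoungDiagram := rectDiagram (b.1 + 1) (b.2 + 1)

/-- The boxes of a Young diagram in the columnar reading order: the columns from left to right,
each of them from top to bottom. -/
def columnarBoxes (μ : YoungDiagram) : List (ℕ × ℕ) :=
  (List.range (μ.rowLen 0)).flatMap fun c => (List.range (μ.colLen c)).map fun r => (r, c)

/-! ### Quivers with frozen vertices -/

/-- A quiver whose vertices are frozen or mutable; `arrows a b` is the number of arrows from `a`
to `b`. -/
structure IceQuiver where
  Vertex : Type
  frozen : Vertex → Prop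
  arrows : Vertex → Vertex → ℕ

/-- The quiver obtained by keeping only the vertices with the property `p`. -/
def IceQuiver.restrict (Q : IceQuiver) (p : Q.Vertex → Prop) : IceQuiver where
  Vertex := {a : Q.Vertex // p a}
  frozen a := Q.frozen a.1
  arrows a b := Q.arrows a.1 b.1

/-- An isomorphism of quivers with frozen vertices. -/
structure IceQuiver.Iso (Q R : IceQuiver) where
  toEquiv : Q.Vertex ≃ R.Vertex
  frozen_iff : ∀ a, R.frozen (toEquiv a) ↔ Q.frozen a
  arrows_eq : ∀ a b, R.arrows (toEquiv a) (toEquiv b) = Q.arrows a b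

/-- The frozen boxes of `lam`: those whose southeast neighbour is not a box of `lam`. -/
def IsFrozenBox (lam : YoungDiagram) (b : ℕ × ℕ) : Prop := (b.1 + 1, b.2 + 1) ∉ lam

open Classical in
/-- The quiver on the boxes of `lam`: arrows between adjacent boxes point up or to the left, there
is an arrow from the upper left to the lower right box of every `2 × 2` square in `lam`, and there
are no arrows between two frozen boxes. -/
noncomputable def boxQuiver (lam : YoungDiagram) : IceQuiver where
  Vertex := {b : ℕ × ℕ // b ∈ lam}
  frozen b := IsFrozenBox lam b.1
  arrows a b :=
    if (a.1 = (b.1.1 + 1, b.1.2) ∨ a.1 = (b.1.1, b.1.2 + 1) ∨ b.1 = (a.1.1 + 1, a.1.2 + 1)) ∧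
      ¬ (IsFrozenBox lam a.1 ∧ IsFrozenBox lam b.1) then 1 else 0

/-- The quiver `Q_{v, w}` of the rectangles seed: the quiver on the boxes of the Young diagram with
vertical steps `x([k])`, where `w = x v`. -/
noncomputable def rectanglesQuiver {n : ℕ} (k : ℕ) (v w : Equiv.Perm (Fin n)) : IceQuiver :=
  boxQuiver (diagramOfSteps ((initialSubset n k).map (w * v⁻¹).toEmbedding))

/-! ### Plabic graphs -/

/-- The colours of the internal vertices. -/
inductive PlabicColor
  | white
  | black
  deriving DecidableEq

/-- The other colour. -/
def PlabicColor.other : PlabicColor → PlabicColor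
  | .white => .black
  | .black => .white

/-- A bipartite graph drawn on an oriented surface with a boundary circle, given by its darts
(edges with a chosen direction, so that every edge has two darts) and their cyclic order around
every vertex.

* `rev d` is the same edge, in the other direction.
* `rot d` is the dart that follows `d` counterclockwise around the initial vertex of `d`; so the
  vertices are the cycles of `rot`.
* `bd i` is the only dart that starts at the boundary vertex `i`.  The boundary vertices are in
  clockwise order on the boundary circle.
* `kind d` describes the initial vertex of `d`: it is the boundary vertex `i` (`Sum.inl i`), or an
  internal vertex of colour `c` (`Sum.inr c`).

Every boundary vertex is adjacent to a single internal vertex and adjacent internal vertices have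
different colours.  The maps built below are drawn in a disk: one starts with lollipops in a disk,
puts vertices on edges, and draws new edges inside a face. -/
structure PlabicMap (n : ℕ) where
  Dart : Type
  [fintypeDart : Fintype Dart]
  [decEqDart : DecidableEq Dart]
  rev : Dart → Dart
  rot : Equiv.Perm Dart
  bd : Fin n → Dart
  kind : Dart → Fin n ⊕ PlabicColor
  rev_rev : ∀ d, rev (rev d) = d
  rev_ne : ∀ d, rev d ≠ d
  kind_rot : ∀ d, kind (rot d) = kind d
  kind_eq_inl_iff : ∀ d i, kind d = Sum.inl i ↔ d = bd i
  kind_rev_bd : ∀ i j, kind (rev (bd i)) ≠ Sum.inl j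
  bipartite : ∀ d c, kind d = Sum.inr c → kind (rev d) ≠ Sum.inr c

namespace PlabicMap

attribute [instance] PlabicMap.fintypeDart PlabicMap.decEqDart

variable {n : ℕ}

/-- The lollipop graph with white lollipops at `[k]` and black lollipops at `[k + 1, n]`. The dart
`(i, false)` starts at the boundary vertex `i`, the dart `(i, true)` at its lollipop. -/
def lollipops (n k : ℕ) : PlabicMap n where
  Dart := Fin n × Bool
  rev d := (d.1, !d.2)
  rot := 1
  bd i := (i, false)
  kind d := if d.2 then Sum.inr (if (d.1 : ℕ) < k then .white else .black) else Sum.inl d.1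
  rev_rev := by rintro ⟨i, b⟩; simp
  rev_ne := by rintro ⟨i, b⟩; simp
  kind_rot := by intro d; rfl
  kind_eq_inl_iff := by rintro ⟨i, _ | _⟩ j <;> simp
  kind_rev_bd := by intro i j; simp
  bipartite := by rintro ⟨i, _ | _⟩ c <;> simp

/-- Put a new vertex of colour `c` in the middle of the edge at the boundary vertex `i`. The two
new darts start at the new vertex, `Sum.inr true` towards the boundary vertex and `Sum.inr false`
towards the interior. -/
def subdivide (G : PlabicMap n) (i : Fin n) (c : PlabicColor)
    (h : G.kind (G.rev (G.bd i)) ≠ Sum.inr c) : PlabicMap n where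
  Dart := G.Dart ⊕ Bool
  rev
    | Sum.inl d =>
      if d = G.bd i then Sum.inr true
      else if d = G.rev (G.bd i) then Sum.inr false else Sum.inl (G.rev d)
    | Sum.inr true => Sum.inl (G.bd i)
    | Sum.inr false => Sum.inl (G.rev (G.bd i))
  rot := Equiv.sumCongr G.rot Equiv.boolNot
  bd j := Sum.inl (G.bd j)
  kind
    | Sum.inl d => G.kind d
    | Sum.inr _ => Sum.inr c
  rev_rev := by
    have h1 := G.rev_rev
    have h2 := G.rev_ne
    rintro (d | (_ | _)) <;> grind
  rev_ne := by
    have h1 := G.rev_rev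
    have h2 := G.rev_ne
    rintro (d | (_ | _)) <;> grind
  kind_rot := by rintro (d | (_ | _)) <;> simp [G.kind_rot]
  kind_eq_inl_iff := by rintro (d | (_ | _)) j <;> simp [G.kind_eq_inl_iff]
  kind_rev_bd := by
    intro j l
    have h1 := G.kind_rev_bd
    have h3 := G.kind_eq_inl_iff
    by_cases hj : G.bd j = G.bd i
    · simp [hj]
    · have hj' : G.bd j ≠ G.rev (G.bd i) := fun e => h1 i j ((h3 _ _).2 e.symm)
      simp [hj, hj', h1]
  bipartite := by
    have h1 := G.rev_rev
    have h2 := G.rev_ne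
    have h3 := G.bipartite
    have h4 := fun j => (G.kind_eq_inl_iff (G.bd j) j).2 rfl
    rintro (d | (_ | _)) c' <;> grind

/-- Draw a new edge between the initial vertices of the darts `d` and `e`, the first white and the
second black. The new dart `Sum.inr true` at the initial vertex of `d` comes immediately before `d`
in counterclockwise order, the new dart `Sum.inr false` at the initial vertex of `e` comes
immediately after `e`. -/
def addEdge (G : PlabicMap n) (d e : G.Dart) (hd : G.kind d = Sum.inr .white)
    (he : G.kind e = Sum.inr .black) : PlabicMap n where
  Dart := G.Dart ⊕ Bool
  rev
    | Sum.inl f => Sum.inl (G.rev f)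
    | Sum.inr b => Sum.inr (!b)
  rot := Equiv.swap (Sum.inr true) (Sum.inl d) * Equiv.sumCongr G.rot (Equiv.refl Bool) *
    Equiv.swap (Sum.inl e) (Sum.inr false)
  bd j := Sum.inl (G.bd j)
  kind
    | Sum.inl f => G.kind f
    | Sum.inr true => Sum.inr .white
    | Sum.inr false => Sum.inr .black
  rev_rev := by rintro (f | (_ | _)) <;> simp [G.rev_rev]
  rev_ne := by rintro (f | (_ | _)) <;> simp [G.rev_ne]
  kind_rot := by
    have h1 := G.kind_rot
    rintro (f | (_ | _)) <;>
      simp only [Equiv.Perm.mul_apply, Equiv.swap_apply_def] <;> grind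
  kind_eq_inl_iff := by rintro (f | (_ | _)) j <;> simp [G.kind_eq_inl_iff]
  kind_rev_bd := by intro j l; simp [G.kind_rev_bd]
  bipartite := by
    have h3 := G.bipartite
    rintro (f | (_ | _)) c' <;> grind

/-- The boundary vertex `i` is adjacent to a lollipop (a vertex of degree one). -/
def IsLollipop (G : PlabicMap n) (i : Fin n) : Prop :=
  G.rot (G.rev (G.bd i)) = G.rev (G.bd i)

instance (G : PlabicMap n) (i : Fin n) : Decidable (G.IsLollipop i) :=
  inferInstanceAs (Decidable (_ = _))

theorem other_ne (c : PlabicColor) : c.other ≠ c := by cases c <;> simp [PlabicColor.other]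

theorem kind_rev_bd_subdivide (G : PlabicMap n) (i : Fin n) (c : PlabicColor)
    (h : G.kind (G.rev (G.bd i)) ≠ Sum.inr c) :
    (G.subdivide i c h).kind ((G.subdivide i c h).rev ((G.subdivide i c h).bd i)) = Sum.inr c := by
  simp [subdivide]

theorem kind_rev_bd_subdivide_ne (G : PlabicMap n) (i j : Fin n) (hij : j ≠ i) (c : PlabicColor)
    (h : G.kind (G.rev (G.bd i)) ≠ Sum.inr c) :
    (G.subdivide i c h).kind ((G.subdivide i c h).rev ((G.subdivide i c h).bd j)) =
      G.kind (G.rev (G.bd j)) := by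
  have h1 := G.kind_rev_bd
  have h3 := G.kind_eq_inl_iff
  have hj : G.bd j ≠ G.bd i := fun e =>
    hij (Sum.inl_injective (((h3 _ _).2 rfl).symm.trans ((h3 _ _).2 e)))
  have hj' : G.bd j ≠ G.rev (G.bd i) := fun e => h1 i j ((h3 _ _).2 e.symm)
  simp [subdivide, hj, hj']

/-- Provide the end of colour `c` of a new bridge on the edge at the boundary vertex `i`. A lollipop
of colour `c` is used itself. Otherwise a new vertex of colour `c` is put on the edge, separated by
a vertex of degree two from the old neighbour of `i` if the old neighbour has colour `c`, too. -/
def bridgeEnd (G : PlabicMap n) (i : Fin n) (c : PlabicColor) : PlabicMap n :=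
  if h : G.kind (G.rev (G.bd i)) = Sum.inr c then
    if G.IsLollipop i then G
    else
      (G.subdivide i c.other (by rw [h]; simpa using (other_ne c).symm)).subdivide i c
        (by rw [kind_rev_bd_subdivide]; simpa using other_ne c)
  else G.subdivide i c h

theorem kind_rev_bd_bridgeEnd (G : PlabicMap n) (i : Fin n) (c : PlabicColor) :
    (G.bridgeEnd i c).kind ((G.bridgeEnd i c).rev ((G.bridgeEnd i c).bd i)) = Sum.inr c := by
  by_cases h : G.kind (G.rev (G.bd i)) = Sum.inr c
  · by_cases h' : G.IsLollipop i
    · have e : G.bridgeEnd i c = G := by rw [bridgeEnd, dif_pos h, if_pos h']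
      rw [e, h]
    · rw [bridgeEnd, dif_pos h, if_neg h']
      exact kind_rev_bd_subdivide _ _ _ _
  · rw [bridgeEnd, dif_neg h]
    exact kind_rev_bd_subdivide _ _ _ _

theorem kind_rev_bd_bridgeEnd_ne (G : PlabicMap n) (i j : Fin n) (hij : j ≠ i) (c : PlabicColor) :
    (G.bridgeEnd i c).kind ((G.bridgeEnd i c).rev ((G.bridgeEnd i c).bd j)) =
      G.kind (G.rev (G.bd j)) := by
  by_cases h : G.kind (G.rev (G.bd i)) = Sum.inr c
  · by_cases h' : G.IsLollipop i
    · have e : G.bridgeEnd i c = G := by rw [bridgeEnd, dif_pos h, if_pos h']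
      rw [e]
    · rw [bridgeEnd, dif_pos h, if_neg h', kind_rev_bd_subdivide_ne _ _ _ hij,
        kind_rev_bd_subdivide_ne _ _ _ hij]
  · rw [bridgeEnd, dif_neg h, kind_rev_bd_subdivide_ne _ _ _ hij]

/-- Add an `(a  b)`-bridge, with its white end on the edge at `a` and its black end on the edge at
`b`. It is drawn in the face along the boundary arc from `a` clockwise to `b`. -/
def addBridge (G : PlabicMap n) (a b : Fin n) (hab : a ≠ b) : PlabicMap n :=
  let H := (G.bridgeEnd a .white).bridgeEnd b .black
  H.addEdge (H.rev (H.bd a)) (H.rev (H.bd b))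
    (by rw [kind_rev_bd_bridgeEnd_ne _ _ _ hab, kind_rev_bd_bridgeEnd])
    (kind_rev_bd_bridgeEnd _ _ _)

/-- Add a bridge at two neighbouring boundary vertices, the ones with the numbers `j` and `j + 1`
in `Fin n`. -/
def addSimpleBridge (G : PlabicMap n) (j : ℕ) : PlabicMap n :=
  if h : j + 1 < n then
    G.addBridge ⟨j, Nat.lt_of_succ_lt h⟩ ⟨j + 1, h⟩ (by simp [Fin.ext_iff])
  else G

/-! #### Trips -/

/-- The dart after `d` on a trip: turn maximally left at a white vertex, maximally right at a black
vertex, and stop at the boundary. -/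
def tripNext (G : PlabicMap n) (d : G.Dart) : Option G.Dart :=
  match G.kind (G.rev d) with
  | Sum.inl _ => none
  | Sum.inr .white => some (G.rot.symm (G.rev d))
  | Sum.inr .black => some (G.rot (G.rev d))

/-- The dart `d` is on the trip that starts at the boundary vertex `i`. -/
def OnTrip (G : PlabicMap n) (i : Fin n) (d : G.Dart) : Prop :=
  Relation.ReflTransGen (fun e f => G.tripNext e = some f) (G.bd i) d

/-- The trip that starts at the boundary vertex `i` ends at the boundary vertex `j`. -/
def IsTrip (G : PlabicMap n) (i j : Fin n) : Prop := G.OnTrip i (G.rev (G.bd j))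

/-! #### Faces -/

/-- The next dart along the face to the left of `d`: turn maximally left at an internal vertex; at
the boundary vertex `i`, follow the boundary circle counterclockwise, and go on from `i - 1`. -/
def faceNext (G : PlabicMap n) (d : G.Dart) : G.Dart :=
  match G.kind (G.rev d) with
  | Sum.inl i => G.bd ((finRotate n).symm i)
  | Sum.inr _ => G.rot.symm (G.rev d)

/-- The faces, as the orbits of `faceNext`. -/
def Face (G : PlabicMap n) : Type := Quot fun d e : G.Dart => G.faceNext d = e

/-- The face to the left of a dart. -/
def leftFace (G : PlabicMap n) (d : G.Dart) : G.Face := Quot.mk _ d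

/-- The face to the right of a dart. -/
def rightFace (G : PlabicMap n) (d : G.Dart) : G.Face := G.leftFace (G.rev d)

/-- The face is incident to the boundary circle (`G.leftFace (G.bd i)` is the face along the
boundary arc from `i` clockwise to the next boundary vertex). -/
def IsBoundaryFace (G : PlabicMap n) (F : G.Face) : Prop := ∃ i, G.leftFace (G.bd i) = F

/-- The face `F` is to the left of the trip `T` that starts at `i`: a path from the left side of `T`
leads to `F` that crosses only edges which are not on `T`. -/
def IsLeftOfTrip (G : PlabicMap n) (i : Fin n) (F : G.Face) : Prop :=
  ∃ d, G.OnTrip i d ∧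
    Relation.ReflTransGen
      (fun F₁ F₂ => ∃ e, ¬ G.OnTrip i e ∧ ¬ G.OnTrip i (G.rev e) ∧
        G.leftFace e = F₁ ∧ G.rightFace e = F₂)
      (G.leftFace d) F

/-- The target label of a face: the set of all `j` such that the face is to the left of the trip
that ends at `j`; a white lollipop at `j` counts for all faces, a black one for none. -/
def targetLabel (G : PlabicMap n) (F : G.Face) : Set (Fin n) :=
  {j | (∃ i, i ≠ j ∧ G.IsTrip i j ∧ G.IsLeftOfTrip i F) ∨
    (G.IsTrip j j ∧ G.IsLollipop j ∧ G.kind (G.rev (G.bd j)) = Sum.inr .white)}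

/-! #### The dual quiver -/

/-- The number of edges that one crosses from `F₁` to `F₂` with the white endpoint to the left and
the black endpoint to the right. -/
noncomputable def crossings (G : PlabicMap n) (F₁ F₂ : G.Face) : ℕ :=
  {d : G.Dart | G.kind d = Sum.inr .white ∧ G.kind (G.rev d) = Sum.inr .black ∧
    G.rightFace d = F₁ ∧ G.leftFace d = F₂}.ncard

open Classical in
/-- The dual quiver. Its vertices are the faces; those on the boundary are frozen. Every edge
between two faces that are not both frozen gives an arrow, which has the white endpoint of the edge
to its left; oriented 2-cycles are removed. -/
noncomputable def dualQuiver (G : PlabicMap n) : IceQuiver where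
  Vertex := G.Face
  frozen := G.IsBoundaryFace
  arrows F₁ F₂ :=
    if G.IsBoundaryFace F₁ ∧ G.IsBoundaryFace F₂ then 0
    else G.crossings F₁ F₂ - G.crossings F₂ F₁

end PlabicMap

/-- The bridge graph `B_{w_K, w}`, where `w = x w_K`: start with white lollipops at `[k]` and
black lollipops elsewhere and add the bridges `s_{i_1}, s_{i_2}, …` in this order, where
`… s_{i_2} s_{i_1}` is the columnar expression for `x`. The box in row `r` and column `c` (numbered
from `0`) of the Young diagram with vertical steps `x([k])` has the simple transposition of
the elements `k - 1 - r + c` and `k - r + c` of `Fin n`. -/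
def bridgeGraph {n : ℕ} (k : ℕ) (wK w : Equiv.Perm (Fin n)) : PlabicMap n :=
  (columnarBoxes (diagramOfSteps ((initialSubset n k).map (w * wK⁻¹).toEmbedding))).foldl
    (fun G b => G.addSimpleBridge ((k - 1 - b.1) + b.2)) (PlabicMap.lollipops n k)

/-! ### Coordinates on the darts of a bridge graph -/

/-! Rows, columns and boundary vertices are numbered from 0 here. The bridges are added in the order
in which the boxes of the diagram are read, so the final graph has a white and a black vertex for
every box, joined by its bridge, and the lollipops that no bridge has used. Away from the bridge,
the white vertex of `(r, c)` is joined outwards to the black vertex of `(r + 1, c)`, and the black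
vertex of `(r, c)` to the white vertex of `(r, c + 1)`; if that box is missing, the edge runs to the
boundary. Colours thus alternate along every strand and no extra vertex of degree two is needed. All
darts get explicit names, and reversal and rotation become formulas (`DartNaming.bridgeGraph`); the
rest is a computation in these coordinates.

Faces: the face of a box lies between its own bridge and the bridge of its southeast neighbour, or
the boundary circle if there is no such neighbour. All other sides of edges belong to one outer
face, which meets the arc from the last boundary vertex to the first. A box (or `none`) is attached
to each dart; it is constant on faces (`faceBox_faceNext`) and distinguishes them
(`boxOfFace_injective`).

Trips: apart from lollipops, the trip ending at `j < k` comes in along row `k - 1 - j`, the one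
ending at `j ≥ k` along column `j - k`; both then leave along the diagonal staircase that reaches
the boundary at `j`. So the end of the trip through a dart is a formula in its name (`onTrip_iff`).
The arithmetic predicate `IsLeftBox` holds on the left of each dart of the trip, fails on its right,
and does not change across other edges. Hence it computes the target labels (`mem_targetLabel_iff`),
and for a box it is membership in the vertical steps of its rectangle (`mem_verticalSteps_rect`).

Quiver: the bridge of a box gives an arrow from its northwest neighbour, and the two kinds of strand
edges give the arrows to the left and up, where a missing neighbour means the outer face
(`crossings_eq`). At the outer face the arrows cancel in pairs, except at the box `(0, 0)`, which
has two arrows out and one in. -/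

/-- Names for the darts of the bridge graph of a Young diagram. The box `(r, c)` has a white and a
black vertex, joined by its bridge. The darts `wo r c`, `wb r c` start at the white vertex of the
box `(r, c)`, towards the boundary and along the bridge, `wi r c` starts at the white vertex of
the box `(r, c + 1)`, away from the boundary; `bo r c` and `bb r c` start at the black vertex of
`(r, c)`, and `bi r c` at the black vertex of `(r + 1, c)`. -/
inductive BridgeDart
  | bd (i : ℕ)
  | wo (r c : ℕ)
  | wi (r c : ℕ)
  | wb (r c : ℕ)
  | bo (r c : ℕ)
  | bi (r c : ℕ)
  | bb (r c : ℕ)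
  deriving DecidableEq

namespace BridgeDart

/-- The colour of the initial vertex. -/
def color : BridgeDart → Option PlabicColor
  | bd _ => none
  | wo _ _ | wi _ _ | wb _ _ => some .white
  | bo _ _ | bi _ _ | bb _ _ => some .black

/-- The darts that exist in the bridge graph of the set of boxes `S`. -/
def Valid (n k : ℕ) (S : Set (ℕ × ℕ)) : BridgeDart → Prop
  | bd i => i < n
  | wo r c => (r, c) ∈ S ∨ (c = 0 ∧ r < k)
  | wi r c => (r, c + 1) ∈ S
  | wb r c => (r, c) ∈ S
  | bo r c => (r, c) ∈ S ∨ (r = 0 ∧ c < n - k)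
  | bi r c => (r + 1, c) ∈ S
  | bb r c => (r, c) ∈ S

open Classical in
/-- The reversed dart (for darts that do not start at the boundary). -/
noncomputable def rv (k : ℕ) (S : Set (ℕ × ℕ)) : BridgeDart → BridgeDart
  | bd i => bd i
  | wo r c => if (r + 1, c) ∈ S then bi r c else bd (k - 1 - r + c)
  | wi r c => bo r c
  | wb r c => bb r c
  | bo r c => if (r, c + 1) ∈ S then wi r c else bd (k - 1 - r + c + 1)
  | bi r c => wo r c
  | bb r c => wb r c

open Classical in
/-- The counterclockwise rotation around the initial vertex. -/
noncomputable def rt (S : Set (ℕ × ℕ)) : BridgeDart → BridgeDart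
  | bd i => bd i
  | wo r 0 => if (r, 0) ∈ S then wb r 0 else wo r 0
  | wo r (c + 1) => wi r c
  | wi r c => wb r (c + 1)
  | wb r c => wo r c
  | bo r c => if (r, c) ∈ S then bb r c else bo r c
  | bb 0 c => bo 0 c
  | bb (r + 1) c => bi r c
  | bi r c => bo (r + 1) c

open Classical in
/-- The clockwise rotation around the initial vertex. -/
noncomputable def rtInv (S : Set (ℕ × ℕ)) : BridgeDart → BridgeDart
  | bd i => bd i
  | wo r c => if (r, c) ∈ S then wb r c else wo r c
  | wb r 0 => wo r 0
  | wb r (c + 1) => wi r c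
  | wi r c => wo r (c + 1)
  | bo 0 c => if (0, c) ∈ S then bb 0 c else bo 0 c
  | bo (r + 1) c => bi r c
  | bi r c => bb (r + 1) c
  | bb r c => bo r c

end BridgeDart

/-! ### Dart names under the operations that build a plabic map -/

open BridgeDart (Valid color)

/-- Names for the darts of a plabic map, such that `V` says which names are in use, and `rv` and
`rt` describe the reversal and the rotation. -/
structure DartNaming {n : ℕ} (G : PlabicMap n) (V : BridgeDart → Prop)
    (rv rt : BridgeDart → BridgeDart) where
  φ : G.Dart → BridgeDart
  inj : Function.Injective φ
  range : ∀ x, V x ↔ ∃ d, φ d = x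
  bd : ∀ i, φ (G.bd i) = .bd i
  bd_lt : ∀ i, V (.bd i) → i < n
  kind : ∀ d c, color (φ d) = some c → G.kind d = Sum.inr c
  rev : ∀ d, color (φ d) ≠ none → φ (G.rev d) = rv (φ d)
  rot : ∀ d, color (φ d) ≠ none → φ (G.rot d) = rt (φ d)

namespace DartNaming

open BridgeDart

variable {n : ℕ} {G : PlabicMap n} {V : BridgeDart → Prop} {rv rt : BridgeDart → BridgeDart}

/-- The formulas matter only on names in use that do not start at the boundary. This replaces the
nested conditionals left by each operation by `BridgeDart.rv` and `BridgeDart.rt` of the enlarged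
set of boxes. -/
theorem congr (N : DartNaming G V rv rt) {V' : BridgeDart → Prop}
    {rv' rt' : BridgeDart → BridgeDart} (hV : ∀ x, V x ↔ V' x)
    (hrv : ∀ x, V x → color x ≠ none → rv x = rv' x)
    (hrt : ∀ x, V x → color x ≠ none → rt x = rt' x) : Nonempty (DartNaming G V' rv' rt') :=
  ⟨{ φ := N.φ
     inj := N.inj
     range := fun x => (hV x).symm.trans (N.range x)
     bd := N.bd
     bd_lt := fun i h => N.bd_lt i ((hV _).2 h)
     kind := N.kind
     rev := fun d h => (N.rev d h).trans (hrv _ ((N.range _).2 ⟨d, rfl⟩) h)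
     rot := fun d h => (N.rot d h).trans (hrt _ ((N.range _).2 ⟨d, rfl⟩) h) }⟩

/-- The formula for the reversal says nothing about darts at the boundary. Since reversal is an
involution, the reverse of such a dart is found as the name that `rv` sends to it. -/
theorem rev_bd (N : DartNaming G V rv rt) {i : Fin n} {x : BridgeDart} (hx : V x)
    (hc : color x ≠ none) (h : rv x = .bd i) : N.φ (G.rev (G.bd i)) = x := by
  obtain ⟨d, rfl⟩ := (N.range x).1 hx
  have : G.rev d = G.bd i := N.inj (by rw [N.rev d hc, h, N.bd])
  rw [← this, G.rev_rev]

theorem eq_bd (N : DartNaming G V rv rt) {d : G.Dart} {i : ℕ} (h : N.φ d = .bd i) :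
    ∃ hi : i < n, d = G.bd ⟨i, hi⟩ := by
  have hi := N.bd_lt i ((N.range _).2 ⟨d, h⟩)
  exact ⟨hi, N.inj (by rw [h, N.bd])⟩

theorem color_ne_none (N : DartNaming G V rv rt) {d : G.Dart} (h : ∀ i, d ≠ G.bd i) :
    color (N.φ d) ≠ none := by
  intro hc
  cases hd : N.φ d with
  | bd i =>
    obtain ⟨hi, e⟩ := N.eq_bd hd
    exact h _ e
  | _ => rw [hd] at hc; simp [color] at hc

theorem ne_bd (N : DartNaming G V rv rt) {d : G.Dart} (h : color (N.φ d) ≠ none) (i : Fin n) :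
    d ≠ G.bd i := by
  rintro rfl
  rw [N.bd] at h
  exact h rfl

/-- Here `x` names the new dart towards the boundary, `y` the new dart towards the interior, and `p`
the dart that used to end at `i` and now meets `y`. -/
theorem subdivide (N : DartNaming G V rv rt) (i : Fin n) (c : PlabicColor)
    (h : G.kind (G.rev (G.bd i)) ≠ Sum.inr c) {x y p : BridgeDart}
    (hp : N.φ (G.rev (G.bd i)) = p) (hx : ¬ V x) (hy : ¬ V y) (hxy : x ≠ y)
    (hxc : color x = some c) (hyc : color y = some c) :
    Nonempty (DartNaming (G.subdivide i c h) (fun z => V z ∨ z = x ∨ z = y)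
      (fun z => if z = x then .bd i else if z = y then p else if z = p then y else rv z)
      (fun z => if z = x then y else if z = y then x else rt z)) := by
  have hVφ : ∀ d, V (N.φ d) := fun d => (N.range _).2 ⟨d, rfl⟩
  have hφx : ∀ d, N.φ d ≠ x := fun d e => hx (e ▸ hVφ d)
  have hφy : ∀ d, N.φ d ≠ y := fun d e => hy (e ▸ hVφ d)
  refine ⟨{
    φ := Sum.elim N.φ (fun b => if b then x else y)
    inj := ?_, range := ?_, bd := ?_, bd_lt := ?_, kind := ?_, rev := ?_, rot := ?_ }⟩
  · refine N.inj.sumElim ?_ ?_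
    · rintro (_ | _) (_ | _) h' <;> simp_all
    · rintro d (_ | _)
      · exact hφy d
      · exact hφx d
  · intro z
    rw [N.range]
    constructor
    · rintro (⟨d, rfl⟩ | rfl | rfl)
      · exact ⟨Sum.inl d, rfl⟩
      · exact ⟨Sum.inr true, rfl⟩
      · exact ⟨Sum.inr false, rfl⟩
    · rintro ⟨d | (_ | _), rfl⟩
      · exact Or.inl ⟨d, rfl⟩
      · exact Or.inr (Or.inr rfl)
      · exact Or.inr (Or.inl rfl)
  · intro j; exact N.bd j
  · rintro j (hj | rfl | rfl)
    · exact N.bd_lt j hj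
    · simp [color] at hxc
    · simp [color] at hyc
  · rintro (d | (_ | _)) c' hc'
    · exact N.kind d c' hc'
    · simp only [Sum.elim_inr, Bool.false_eq_true, if_false, hyc] at hc'
      simp only [PlabicMap.subdivide]; rw [Option.some.inj hc']
    · simp only [Sum.elim_inr, if_true, hxc] at hc'
      simp only [PlabicMap.subdivide]; rw [Option.some.inj hc']
  · rintro (d | (_ | _)) hc
    · have hd : d ≠ G.bd i := N.ne_bd hc i
      by_cases hd' : d = G.rev (G.bd i)
      · subst hd'
        simp [PlabicMap.subdivide, hp, hd]
        simp [← hp, hφx, hφy]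
      · have : N.φ d ≠ p := by rw [← hp]; exact fun e => hd' (N.inj e)
        simp [PlabicMap.subdivide, hφx, hφy, hd, hd', this, N.rev d hc]
    · simp [PlabicMap.subdivide, hxy.symm, hp]
    · simp [PlabicMap.subdivide, N.bd]
  · rintro (d | (_ | _)) hc
    · change N.φ (G.rot d) = _
      have hc' : color (N.φ d) ≠ none := hc
      simp [hφx, hφy, N.rot d hc']
    · change x = _
      simp [hxy.symm]
    · change y = _
      simp

theorem rot_addEdge (d e : G.Dart) (hd : G.kind d = Sum.inr .white)
    (he : G.kind e = Sum.inr .black) (x : G.Dart ⊕ Bool) :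
    (G.addEdge d e hd he).rot x =
      (match x with
        | Sum.inl f => if f = e then Sum.inr false else if G.rot f = d then Sum.inr true
          else Sum.inl (G.rot f)
        | Sum.inr true => Sum.inl d
        | Sum.inr false => if G.rot e = d then Sum.inr true else Sum.inl (G.rot e) :
          G.Dart ⊕ Bool) := by
  change (Equiv.swap (Sum.inr true) (Sum.inl d) * Equiv.sumCongr G.rot (Equiv.refl Bool) *
    Equiv.swap (Sum.inl e) (Sum.inr false) : Equiv.Perm (G.Dart ⊕ Bool)) x = _
  rcases x with f | (_ | _)
  · by_cases h : f = e
    · subst h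
      simp [Equiv.swap_apply_def]
    · simp only [Equiv.Perm.mul_apply, Equiv.swap_apply_def]
      by_cases h' : G.rot f = d <;> simp [h, h']
  · simp only [Equiv.Perm.mul_apply, Equiv.swap_apply_def]
    by_cases h' : G.rot e = d <;> simp [h']
  · simp [Equiv.swap_apply_def]

/-- The new dart `u` is spliced in before `p` and `v` after `q`. As `d` and `e` start at vertices of
different colours, the two splices happen in different cycles of the rotation and do not interact.
-/
theorem addEdge (N : DartNaming G V rv rt) (d e : G.Dart) (hd : G.kind d = Sum.inr .white)
    (he : G.kind e = Sum.inr .black) {p q u v : BridgeDart} (hp : N.φ d = p) (hq : N.φ e = q)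
    (hu : ¬ V u) (hv : ¬ V v) (huc : color u = some .white) (hvc : color v = some .black) :
    Nonempty (DartNaming (G.addEdge d e hd he) (fun z => V z ∨ z = u ∨ z = v)
      (fun z => if z = u then v else if z = v then u else rv z)
      (fun z => if z = u then p else if z = q then v else if z = v then rt q
        else if rt z = p then u else rt z)) := by
  have hVφ : ∀ d, V (N.φ d) := fun d => (N.range _).2 ⟨d, rfl⟩
  have hφu : ∀ d, N.φ d ≠ u := fun d e => hu (e ▸ hVφ d)
  have hφv : ∀ d, N.φ d ≠ v := fun d e => hv (e ▸ hVφ d)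
  have huv : u ≠ v := by rintro rfl; simp [huc] at hvc
  have hqc : color q ≠ none := by
    rw [← hq]
    exact N.color_ne_none fun i h => by
      have := (G.kind_eq_inl_iff e i).2 h
      simp [he] at this
  -- The rotation preserves the colour, so the successor of a black dart is never the white dart
  -- `d`.
  have hrot : ∀ f, G.kind f = Sum.inr .black → G.rot f ≠ d := by
    intro f hf h
    have := G.kind_rot f
    rw [h, hd, hf] at this
    simp at this
  refine ⟨{
    φ := Sum.elim N.φ (fun b => if b then u else v)
    inj := ?_, range := ?_, bd := ?_, bd_lt := ?_, kind := ?_, rev := ?_, rot := ?_ }⟩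
  · refine N.inj.sumElim ?_ ?_
    · rintro (_ | _) (_ | _) h' <;> simp_all
    · rintro d (_ | _)
      · exact hφv d
      · exact hφu d
  · intro z
    rw [N.range]
    constructor
    · rintro (⟨d, rfl⟩ | rfl | rfl)
      · exact ⟨Sum.inl d, rfl⟩
      · exact ⟨Sum.inr true, rfl⟩
      · exact ⟨Sum.inr false, rfl⟩
    · rintro ⟨d | (_ | _), rfl⟩
      · exact Or.inl ⟨d, rfl⟩
      · exact Or.inr (Or.inr rfl)
      · exact Or.inr (Or.inl rfl)
  · intro j; exact N.bd j
  · rintro j (hj | rfl | rfl)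
    · exact N.bd_lt j hj
    · simp [color] at huc
    · simp [color] at hvc
  · rintro (d | (_ | _)) c' hc'
    · exact N.kind d c' hc'
    · simp only [Sum.elim_inr, Bool.false_eq_true, if_false, hvc] at hc'
      simp only [PlabicMap.addEdge]; rw [Option.some.inj hc']
    · simp only [Sum.elim_inr, if_true, huc] at hc'
      simp only [PlabicMap.addEdge]; rw [Option.some.inj hc']
  · rintro (f | (_ | _)) hc
    · simp [PlabicMap.addEdge, hφu, hφv, N.rev f hc]
    · simp [PlabicMap.addEdge, huv.symm]
    · simp [PlabicMap.addEdge]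
  · rintro (f | (_ | _)) hc
    · have hfr : N.φ (G.rot f) = rt (N.φ f) := N.rot f hc
      rw [rot_addEdge]
      by_cases hfe : f = e
      · subst hfe
        simp only [if_true, Sum.elim_inl, hq]
        simp [← hq, hφu]
      · have h1 : N.φ f ≠ q := by rw [← hq]; exact fun h => hfe (N.inj h)
        by_cases hfd : G.rot f = d
        · have h2 : rt (N.φ f) = p := by rw [← hfr, hfd, hp]
          simp [hφu, hφv, h1, h2, hfe, hfd]
        · have h2 : rt (N.φ f) ≠ p := by rw [← hfr, ← hp]; exact fun h => hfd (N.inj h)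
          simp [hφu, hφv, h1, h2, hfe, hfd, hfr]
    · have h1 : v ≠ q := by rw [← hq]; exact fun h => hφv e h.symm
      have h2 := N.rot e (by rwa [hq])
      rw [hq] at h2
      rw [rot_addEdge]
      simp [hrot e he, huv.symm, h1, h2]
    · rw [rot_addEdge]
      simp [hp]

end DartNaming

/-! ### Adding one bridge for each box -/

namespace DartNaming

open BridgeDart

variable {n : ℕ} {G : PlabicMap n} {V : BridgeDart → Prop} {rv rt : BridgeDart → BridgeDart}

/-- The equation `rt x = x` says that the neighbour of `i` has degree one, so it is a lollipop,
which serves as the end of the bridge. -/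
theorem bridgeEnd_eq_self (N : DartNaming G V rv rt) (i : Fin n) (c : PlabicColor)
    {x : BridgeDart} (hx : V x) (hxc : color x = some c) (hrv : rv x = .bd i) (hrt : rt x = x) :
    G.bridgeEnd i c = G := by
  have h := N.rev_bd hx (by simp [hxc]) hrv
  have hk : G.kind (G.rev (G.bd i)) = Sum.inr c := N.kind _ _ (by rw [h, hxc])
  have hl : G.IsLollipop i := N.inj (by rw [N.rot _ (by simp [h, hxc]), h, hrt])
  rw [PlabicMap.bridgeEnd, dif_pos hk, if_pos hl]

theorem bridgeEnd_subdivide (N : DartNaming G V rv rt) (i : Fin n) (c : PlabicColor)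
    {x u v : BridgeDart} (hx : V x) (hxc : color x = some c.other) (hrv : rv x = .bd i)
    (hu : ¬ V u) (hv : ¬ V v) (huv : u ≠ v) (huc : color u = some c) (hvc : color v = some c) :
    Nonempty (DartNaming (G.bridgeEnd i c) (fun z => V z ∨ z = u ∨ z = v)
      (fun z => if z = u then .bd i else if z = v then x else if z = x then v else rv z)
      (fun z => if z = u then v else if z = v then u else rt z)) := by
  have h := N.rev_bd hx (by simp [hxc]) hrv
  have hk : G.kind (G.rev (G.bd i)) ≠ Sum.inr c := by
    rw [N.kind _ c.other (by rw [h, hxc])]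
    simpa using PlabicMap.other_ne c
  rw [PlabicMap.bridgeEnd, dif_neg hk]
  exact N.subdivide i c hk h hu hv huv huc hvc

theorem addBridge (a b : Fin n) (hab : a ≠ b)
    (N : DartNaming ((G.bridgeEnd a .white).bridgeEnd b .black) V rv rt)
    {p q u v : BridgeDart} (hpV : V p) (hqV : V q) (hpc : color p ≠ none) (hqc : color q ≠ none)
    (hp : rv p = .bd a) (hq : rv q = .bd b)
    (hu : ¬ V u) (hv : ¬ V v) (huc : color u = some .white) (hvc : color v = some .black) :
    Nonempty (DartNaming (G.addBridge a b hab) (fun z => V z ∨ z = u ∨ z = v)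
      (fun z => if z = u then v else if z = v then u else rv z)
      (fun z => if z = u then p else if z = q then v else if z = v then rt q
        else if rt z = p then u else rt z)) :=
  N.addEdge _ _
    (by rw [PlabicMap.kind_rev_bd_bridgeEnd_ne _ _ _ hab, PlabicMap.kind_rev_bd_bridgeEnd])
    (PlabicMap.kind_rev_bd_bridgeEnd _ _ _) (N.rev_bd hpV hpc hp) (N.rev_bd hqV hqc hq) hu hv huc hvc

/-- The conditions say that `(r, c)` can be added as a corner, so that the strands at `k - 1 - r +
c` and the next vertex end at the expected darts. The white end goes on the strand coming from the
black vertex of `(r, c - 1)`, the black end on the one coming from the white vertex of `(r - 1, c)`.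
The colours differ from those needed, so a single new vertex suffices. In the first column,
respectively the first row, an unused lollipop of the right colour takes the place of the new
vertex; this gives four cases. -/
theorem addSimpleBridge {k : ℕ} {S : Set (ℕ × ℕ)}
    (N : DartNaming G (Valid n k S) (BridgeDart.rv k S) (BridgeDart.rt S)) {r c : ℕ}
    (hr : r < k) (hc : c < n - k) (hrc : (r, c) ∉ S) (hr' : (r + 1, c) ∉ S)
    (hc' : (r, c + 1) ∉ S) (hup : ∀ r', r = r' + 1 → (r', c) ∈ S)
    (hleft : ∀ c', c = c' + 1 → (r, c') ∈ S) :
    Nonempty (DartNaming (G.addSimpleBridge (k - 1 - r + c)) (Valid n k (insert (r, c) S))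
      (BridgeDart.rv k (insert (r, c) S)) (BridgeDart.rt (insert (r, c) S))) := by
  have hlt : k - 1 - r + c + 1 < n := by omega
  rw [PlabicMap.addSimpleBridge, dif_pos hlt]
  set a : Fin n := ⟨k - 1 - r + c, Nat.lt_of_succ_lt hlt⟩ with ha
  set b : Fin n := ⟨k - 1 - r + c + 1, hlt⟩ with hb
  rcases c with _ | c
  · have e1 : G.bridgeEnd a .white = G :=
      N.bridgeEnd_eq_self a .white (x := .wo r 0) (by simp [Valid, hr]) rfl
        (by simp [BridgeDart.rv, hr', ha]) (by simp [BridgeDart.rt, hrc])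
    rcases r with _ | r
    · have e2 : G.bridgeEnd b .black = G :=
        N.bridgeEnd_eq_self b .black (x := .bo 0 0) (by simp [Valid, hc]) rfl
          (by simp [BridgeDart.rv, hc', hb]) (by simp [BridgeDart.rt, hrc])
      have N2 : DartNaming ((G.bridgeEnd a .white).bridgeEnd b .black) (Valid n k S)
          (BridgeDart.rv k S) (BridgeDart.rt S) := by
        rw [e1, e2]; exact N
      obtain ⟨N3⟩ := N2.addBridge a b (by simp [ha, hb]) (p := .wo 0 0) (q := .bo 0 0)
        (u := .wb 0 0) (v := .bb 0 0) (by simp [Valid, hr]) (by simp [Valid, hc])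
        (by simp [color]) (by simp [color]) (by simp [BridgeDart.rv, hr', ha])
        (by simp [BridgeDart.rv, hc', hb]) (by simp [Valid, hrc]) (by simp [Valid, hrc]) rfl rfl
      refine N3.congr ?_ ?_ ?_
      · rintro (_ | _ | _ | _ | _ | _ | _) <;> grind [Valid]
      · rintro (_ | _ | _ | _ | _ | _ | _) <;> grind [Valid, BridgeDart.rv]
      · rintro (_ | ⟨_ | _, _ | _⟩ | _ | _ | ⟨_ | _, _⟩ | _ | ⟨_ | _, _⟩) <;>
          grind [Valid, BridgeDart.rt]
    · obtain ⟨N2⟩ : Nonempty (DartNaming ((G.bridgeEnd a .white).bridgeEnd b .black) _ _ _) := by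
        rw [e1]
        exact N.bridgeEnd_subdivide b .black (x := .wo r 0) (u := .bo (r + 1) 0) (v := .bi r 0)
          (by simp [Valid, hup]) rfl (by simp [BridgeDart.rv, hrc, hb]; omega)
          (by simp [Valid, hrc]) (by simp [Valid, hrc]) (by simp) rfl rfl
      obtain ⟨N3⟩ := N2.addBridge a b (by simp [ha, hb]) (p := .wo (r + 1) 0)
        (q := .bo (r + 1) 0) (u := .wb (r + 1) 0) (v := .bb (r + 1) 0)
        (by simp [Valid, hr]) (by simp)
        (by simp [color]) (by simp [color]) (by simp [BridgeDart.rv, hr', ha])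
        (by simp) (by simp [Valid, hrc]) (by simp [Valid, hrc]) rfl rfl
      refine N3.congr ?_ ?_ ?_
      · rintro (_ | _ | _ | _ | _ | _ | _) <;> grind [Valid]
      · rintro (_ | _ | _ | _ | _ | _ | _) <;> grind [Valid, BridgeDart.rv]
      · rintro (_ | ⟨_ | _, _ | _⟩ | _ | _ | ⟨_ | _, _⟩ | _ | ⟨_ | _, _⟩) <;>
          grind [Valid, BridgeDart.rt]
  · obtain ⟨N1⟩ := N.bridgeEnd_subdivide a .white (x := .bo r c) (u := .wo r (c + 1))
      (v := .wi r c) (by simp [Valid, hleft]) rfl (by simp [BridgeDart.rv, hrc, ha]; omega)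
      (by simp [Valid, hrc]) (by simp [Valid, hrc]) (by simp) rfl rfl
    rcases r with _ | r
    · have e2 : (G.bridgeEnd a .white).bridgeEnd b .black = G.bridgeEnd a .white :=
        N1.bridgeEnd_eq_self b .black (x := .bo 0 (c + 1)) (by simp [Valid, hc]) rfl
          (by simp [BridgeDart.rv, hc', hb]) (by simp [BridgeDart.rt, hrc])
      rw [← e2] at N1
      obtain ⟨N3⟩ := N1.addBridge a b (by simp [ha, hb]) (p := .wo 0 (c + 1))
        (q := .bo 0 (c + 1)) (u := .wb 0 (c + 1)) (v := .bb 0 (c + 1))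
        (by simp) (by simp [Valid, hc])
        (by simp [color]) (by simp [color]) (by simp)
        (by simp [BridgeDart.rv, hc', hb]) (by simp [Valid, hrc]) (by simp [Valid, hrc]) rfl rfl
      refine N3.congr ?_ ?_ ?_
      · rintro (_ | _ | _ | _ | _ | _ | _) <;> grind [Valid]
      · rintro (_ | _ | _ | _ | _ | _ | _) <;> grind [Valid, BridgeDart.rv]
      · rintro (_ | ⟨_ | _, _ | _⟩ | _ | _ | ⟨_ | _, _⟩ | _ | ⟨_ | _, _⟩) <;>
          grind [Valid, BridgeDart.rt]
    · obtain ⟨N2⟩ := N1.bridgeEnd_subdivide b .black (x := .wo r (c + 1))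
        (u := .bo (r + 1) (c + 1)) (v := .bi r (c + 1))
        (by simp [Valid, hup]) rfl (by simp [BridgeDart.rv, hrc, hb]; omega)
        (by simp [Valid, hrc]) (by simp [Valid, hrc]) (by simp) rfl rfl
      obtain ⟨N3⟩ := N2.addBridge a b (by simp [ha, hb]) (p := .wo (r + 1) (c + 1))
        (q := .bo (r + 1) (c + 1)) (u := .wb (r + 1) (c + 1)) (v := .bb (r + 1) (c + 1))
        (by simp) (by simp) (by simp [color]) (by simp [color]) (by simp)
        (by simp) (by simp [Valid, hrc]) (by simp [Valid, hrc]) rfl rfl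
      refine N3.congr ?_ ?_ ?_
      · rintro (_ | _ | _ | _ | _ | _ | _) <;> grind [Valid]
      · rintro (_ | _ | _ | _ | _ | _ | _) <;> grind [Valid, BridgeDart.rv]
      · rintro (_ | ⟨_ | _, _ | _⟩ | _ | _ | ⟨_ | _, _⟩ | _ | ⟨_ | _, _⟩) <;>
          grind [Valid, BridgeDart.rt]

/-- The darts of the lollipop graph. -/
theorem lollipops {k : ℕ} (hk : 0 < k) (hkn : k < n) :
    Nonempty (DartNaming (PlabicMap.lollipops n k) (Valid n k ∅) (BridgeDart.rv k ∅)
      (BridgeDart.rt ∅)) := by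
  refine ⟨{
    -- The white lollipop at `i` begins row `k - 1 - i`, the black one begins column `i - k`.
    φ := fun d : Fin n × Bool => if d.2 then (if (d.1 : ℕ) < k then .wo (k - 1 - d.1) 0
      else .bo 0 (d.1 - k)) else .bd d.1
    inj := ?_, range := ?_, bd := ?_, bd_lt := ?_, kind := ?_, rev := ?_, rot := ?_ }⟩
  · rintro ⟨⟨i, hi⟩, _ | _⟩ ⟨⟨j, hj⟩, _ | _⟩ h <;> dsimp at h ⊢
    · have : i = j := by simpa using h
      subst this; rfl
    · grind
    · grind
    · have : i = j := by split_ifs at h <;> simp at h <;> omega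
      subst this; rfl
  · intro x
    constructor
    · intro hx
      cases x with
      | bd i => exact ⟨(⟨i, hx⟩, false), by simp⟩
      | wo r c =>
        simp only [Valid, Set.mem_empty_iff_false, false_or] at hx
        obtain ⟨rfl, hx⟩ := hx
        exact ⟨(⟨k - 1 - r, by omega⟩, true), by
          simp only [if_true]; rw [if_pos (by omega)]; congr; omega⟩
      | bo r c =>
        simp only [Valid, Set.mem_empty_iff_false, false_or] at hx
        obtain ⟨rfl, hx⟩ := hx
        exact ⟨(⟨k + c, by omega⟩, true), by simp⟩
      | _ => simp [Valid] at hx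
    · rintro ⟨⟨⟨i, hi⟩, _ | _⟩, rfl⟩
      · simpa [Valid] using hi
      · dsimp
        split_ifs <;> simp [Valid] <;> omega
  · intro i; rfl
  · intro i hi; exact hi
  · rintro ⟨⟨i, hi⟩, _ | _⟩ c h
    · simp [color] at h
    · dsimp at h
      simp only [PlabicMap.lollipops]
      split_ifs at h ⊢ <;> simp_all [color]
  · rintro ⟨⟨i, hi⟩, _ | _⟩ h
    · simp [color] at h
    · dsimp [PlabicMap.lollipops]
      split_ifs <;> simp [BridgeDart.rv] <;> omega
  · rintro ⟨⟨i, hi⟩, _ | _⟩ h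
    · simp [color] at h
    · change (if i < k then wo (k - 1 - i) 0 else bo 0 (i - k)) =
        BridgeDart.rt ∅ (if i < k then wo (k - 1 - i) 0 else bo 0 (i - k))
      split_ifs <;> simp [BridgeDart.rt]

/-- Reading a column from the top makes the box above each new box available, and `hleft` provides
the box to its left from the previous column. -/
theorem foldl_column {k : ℕ} {S : Set (ℕ × ℕ)}
    (N : DartNaming G (Valid n k S) (BridgeDart.rv k S) (BridgeDart.rt S)) (C R : ℕ)
    (hR : R ≤ k) (hC : 0 < R → C < n - k) (hS : ∀ b ∈ S, b.2 < C)
    (hleft : ∀ r < R, ∀ c, C = c + 1 → (r, c) ∈ S) :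
    Nonempty (DartNaming (((List.range R).map fun r => (r, C)).foldl
        (fun G b => G.addSimpleBridge ((k - 1 - b.1) + b.2)) G)
      (Valid n k (S ∪ {b | b.1 < R ∧ b.2 = C}))
      (BridgeDart.rv k (S ∪ {b | b.1 < R ∧ b.2 = C}))
      (BridgeDart.rt (S ∪ {b | b.1 < R ∧ b.2 = C}))) := by
  have hSC : ∀ r c, C ≤ c → (r, c) ∉ S := fun r c h hb => absurd (hS _ hb) (by simpa using h)
  induction R with
  | zero => simpa using ⟨N⟩
  | succ R ih =>
    obtain ⟨N'⟩ := ih (by omega) (fun _ => hC (by omega)) fun r hr => hleft r (by omega)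
    rw [List.range_succ, List.map_append, List.foldl_append]
    have e : S ∪ {b | b.1 < R + 1 ∧ b.2 = C} = insert (R, C) (S ∪ {b | b.1 < R ∧ b.2 = C}) := by
      ext ⟨r, c⟩
      simp only [Set.mem_union, Set.mem_ofPred_eq, Set.mem_insert_iff, Prod.mk.injEq]
      grind
    rw [e]
    refine N'.addSimpleBridge (r := R) (c := C) (by omega) (hC (by omega)) ?_ ?_ ?_ ?_ ?_
    · simp [hSC]
    · simp [hSC]
    · simp [hSC]
    · rintro r' rfl
      simp
    · rintro c' rfl
      exact Or.inl (hleft R (by omega) c' rfl)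

theorem bridgeGraph_columns {k : ℕ} (hk : 0 < k) (hkn : k < n) (μ : YoungDiagram)
    (hμ : ∀ b ∈ μ, b.1 < k ∧ b.2 < n - k) (C : ℕ) :
    Nonempty (DartNaming (((List.range C).flatMap fun c =>
        (List.range (μ.colLen c)).map fun r => (r, c)).foldl
        (fun G b => G.addSimpleBridge ((k - 1 - b.1) + b.2)) (PlabicMap.lollipops n k))
      (Valid n k {b | b ∈ μ ∧ b.2 < C}) (BridgeDart.rv k {b | b ∈ μ ∧ b.2 < C})
      (BridgeDart.rt {b | b ∈ μ ∧ b.2 < C})) := by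
  induction C with
  | zero => simpa using lollipops hk hkn
  | succ C ih =>
    obtain ⟨N⟩ := ih
    rw [List.range_succ, List.flatMap_append, List.foldl_append, List.flatMap_singleton]
    have e : {b | b ∈ μ ∧ b.2 < C + 1} =
        {b | b ∈ μ ∧ b.2 < C} ∪ {b : ℕ × ℕ | b.1 < μ.colLen C ∧ b.2 = C} := by
      ext ⟨r, c⟩
      simp only [Set.mem_union, Set.mem_ofPred_eq]
      rw [← YoungDiagram.mem_iff_lt_colLen]
      grind
    rw [e]
    have hcol : ∀ r, r < μ.colLen C → r < k ∧ C < n - k := fun r hr =>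
      hμ _ (YoungDiagram.mem_iff_lt_colLen.2 hr)
    refine N.foldl_column C (μ.colLen C) ?_ (fun h => (hcol 0 h).2) (fun b hb => hb.2) ?_
    · by_contra h
      exact absurd (hcol k (by omega)).1 (lt_irrefl _)
    · rintro r hr c rfl
      exact ⟨μ.isLowerSet (show (r, c) ≤ (r, c + 1) by simp) (YoungDiagram.mem_iff_lt_colLen.2 hr),
        Nat.lt_succ_self c⟩

/-- The darts of the bridge graph of a Young diagram. -/
theorem bridgeGraph {k : ℕ} (hk : 0 < k) (hkn : k < n) (wK w : Equiv.Perm (Fin n))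
    (μ : YoungDiagram) (hw : diagramOfSteps ((initialSubset n k).map (w * wK⁻¹).toEmbedding) = μ)
    (hμ : ∀ b ∈ μ, b.1 < k ∧ b.2 < n - k) :
    Nonempty (DartNaming (_root_.bridgeGraph k wK w) (Valid n k {b | b ∈ μ})
      (BridgeDart.rv k {b | b ∈ μ}) (BridgeDart.rt {b | b ∈ μ})) := by
  have e : {b | b ∈ μ} = {b | b ∈ μ ∧ b.2 < μ.rowLen 0} := by
    ext ⟨r, c⟩
    simp only [Set.mem_ofPred_eq, iff_self_and]
    intro h
    exact YoungDiagram.mem_iff_lt_rowLen.1 (μ.isLowerSet (show (0, c) ≤ (r, c) by simp) h)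
  rw [_root_.bridgeGraph, hw, columnarBoxes, e]
  exact bridgeGraph_columns hk hkn μ hμ _

end DartNaming

/-! ### The box attached to a side of an edge -/

theorem mem_diagramOfSteps {n k : ℕ} (x : Equiv.Perm (Fin n)) {b : ℕ × ℕ}
    (hb : b ∈ diagramOfSteps ((initialSubset n k).map x.toEmbedding)) :
    b.1 < k ∧ b.2 < n - k := by
  set I := (initialSubset n k).map x.toEmbedding with hI
  have hIc : I.card ≤ k := by
    rw [hI, Finset.card_map, initialSubset, Fin.card_filter_val_lt]
    exact min_le_right _ _
  have hIk : k ≤ n → I.card = k := by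
    intro h
    rw [hI, Finset.card_map, initialSubset, Fin.card_filter_val_lt]
    exact min_eq_right h
  have hb' : b.2 < (Finset.univ.filter fun j => j ∉ I ∧ b.1 < (I.filter fun i => j < i).card).card :=
    (Finset.mem_filter.1 hb).2
  constructor
  · obtain ⟨j, hj⟩ := Finset.card_pos.1 (Nat.zero_lt_of_lt hb')
    exact (Finset.mem_filter.1 hj).2.2.trans_le ((Finset.card_filter_le _ _).trans hIc)
  · have h1 : (Finset.univ.filter fun j => j ∉ I ∧ b.1 < (I.filter fun i => j < i).card).card ≤
        Iᶜ.card := by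
      refine Finset.card_le_card fun j hj => ?_
      simp only [Finset.mem_filter, Finset.mem_univ, true_and, Finset.mem_compl] at hj ⊢
      exact hj.1
    rw [Finset.card_compl, Fintype.card_fin] at h1
    by_cases hkn : k ≤ n
    · rw [hIk hkn] at h1; omega
    · have : I.card = n := by
        rw [hI, Finset.card_map, initialSubset, Fin.card_filter_val_lt]
        exact min_eq_left (by omega)
      omega

/-- The set of boxes `S` is a Young diagram in the `k × (n - k)` rectangle. -/
structure IsDiagramIn (n k : ℕ) (S : Set (ℕ × ℕ)) : Prop where
  pos : 0 < k
  lt : k < n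
  row_lt : ∀ r c, (r, c) ∈ S → r < k
  col_lt : ∀ r c, (r, c) ∈ S → c < n - k
  lower : ∀ r c r' c', (r', c') ∈ S → r ≤ r' → c ≤ c' → (r, c) ∈ S

/-- The box to the northwest of `(r, c)`. -/
def nwBox : ℕ → ℕ → Option (ℕ × ℕ)
  | r + 1, c + 1 => some (r, c)
  | _, _ => none

/-- The box above `(r, c)`. -/
def upBox : ℕ → ℕ → Option (ℕ × ℕ)
  | r + 1, c => some (r, c)
  | 0, _ => none

/-- The box to the left of `(r, c)`. -/
def leftBox : ℕ → ℕ → Option (ℕ × ℕ)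
  | r, c + 1 => some (r, c)
  | _, 0 => none

namespace BridgeDart

open Classical in
/-- The box of the face to the left of a dart that does not start at the boundary. -/
noncomputable def leftFaceBox (S : Set (ℕ × ℕ)) : BridgeDart → Option (ℕ × ℕ)
  | bd _ => none
  | wo r c => leftBox r c
  | wi r c => upBox r c
  | wb r c => some (r, c)
  | bo r c => if (r, c) ∈ S then some (r, c) else none
  | bi r c => some (r, c)
  | bb r c => nwBox r c

open Classical in
/-- The box of the face to the right of a dart that does not start at the boundary. -/
noncomputable def rightFaceBox (S : Set (ℕ × ℕ)) : BridgeDart → Option (ℕ × ℕ)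
  | wo r c => if (r, c) ∈ S then some (r, c) else none
  | wi r c => some (r, c)
  | wb r c => nwBox r c
  | bo r c => upBox r c
  | bi r c => leftBox r c
  | bb r c => some (r, c)
  | bd _ => none

theorem rtInv_rt {n k : ℕ} {S : Set (ℕ × ℕ)} {x : BridgeDart} (hx : Valid n k S x) :
    rtInv S (rt S x) = x := by
  rcases x with (_ | ⟨_ | _, _ | _⟩ | _ | _ | ⟨_ | _, _⟩ | _ | ⟨_ | _, _⟩) <;>
    grind [Valid, rt, rtInv]

end BridgeDart

/-- The box `X` is the last one in `S` on the diagonal with the number `a`. -/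
def IsLastOnDiagonal (k : ℕ) (S : Set (ℕ × ℕ)) (a : ℕ) : Option (ℕ × ℕ) → Prop
  | none => ∀ r c, (r, c) ∈ S → k - 1 - r + c ≠ a
  | some b => b ∈ S ∧ (b.1 + 1, b.2 + 1) ∉ S ∧ k - 1 - b.1 + b.2 = a

/-- Of two boxes on one diagonal, one lies strictly northwest of the other. Its southeast neighbour
is then in `S`, as `S` is closed to the northwest, so it was not the last one. -/
theorem IsLastOnDiagonal.unique {n k a : ℕ} {S : Set (ℕ × ℕ)} (hS : IsDiagramIn n k S)
    {X Y : Option (ℕ × ℕ)} (hX : IsLastOnDiagonal k S a X) (hY : IsLastOnDiagonal k S a Y) :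
    X = Y := by
  rcases X with _ | ⟨r, c⟩ <;> rcases Y with _ | ⟨r', c'⟩
  · rfl
  · exact absurd hY.2.2 (hX _ _ hY.1)
  · exact absurd hX.2.2 (hY _ _ hX.1)
  · obtain ⟨h1, h2, h3⟩ := hX
    obtain ⟨h1', h2', h3'⟩ := hY
    dsimp only at *
    have hr := hS.row_lt _ _ h1
    have hr' := hS.row_lt _ _ h1'
    have a1 : ¬ r < r' := fun h => h2 (hS.lower _ _ _ _ h1' (by omega) (by omega))
    have a2 : ¬ r' < r := fun h => h2' (hS.lower _ _ _ _ h1 (by omega) (by omega))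
    have e : r = r' := by omega
    subst e
    have e : c = c' := by omega
    rw [e]

theorem val_finRotate_symm {n : ℕ} (i : Fin n) :
    ((finRotate n).symm i : ℕ) = if (i : ℕ) = 0 then n - 1 else i - 1 := by
  obtain ⟨j, rfl⟩ := (finRotate n).surjective i
  rw [Equiv.symm_apply_apply]
  rcases n with _ | n
  · exact j.elim0
  · by_cases hj : j = Fin.last n
    · subst hj
      simp
    · rw [coe_finRotate_of_ne_last hj]
      simp

namespace DartNaming

open BridgeDart

variable {n k : ℕ} {G : PlabicMap n} {S : Set (ℕ × ℕ)}

theorem valid (N : DartNaming G (Valid n k S) (rv k S) (rt S)) (d : G.Dart) :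
    Valid n k S (N.φ d) := (N.range _).2 ⟨d, rfl⟩

theorem exists_dart (N : DartNaming G (Valid n k S) (rv k S) (rt S)) {x : BridgeDart}
    (hx : Valid n k S x) : ∃ d, N.φ d = x := (N.range _).1 hx

theorem rot_symm (N : DartNaming G (Valid n k S) (rv k S) (rt S)) {d : G.Dart}
    (hd : color (N.φ d) ≠ none) : N.φ (G.rot.symm d) = rtInv S (N.φ d) := by
  obtain ⟨e, rfl⟩ := G.rot.surjective d
  have he : color (N.φ e) ≠ none := N.color_ne_none fun i h => by
    have := G.kind_rot e
    rw [(G.kind_eq_inl_iff e i).2 h, G.kind_eq_inl_iff] at this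
    exact N.ne_bd hd i this
  rw [Equiv.symm_apply_apply, N.rot e he, rtInv_rt (N.valid e)]

theorem rev_bd_cases (N : DartNaming G (Valid n k S) (rv k S) (rt S)) (i : Fin n) :
    (∃ r c, N.φ (G.rev (G.bd i)) = .wo r c ∧ ((r, c) ∈ S ∨ (c = 0 ∧ r < k)) ∧
      (r + 1, c) ∉ S ∧ (i : ℕ) = k - 1 - r + c) ∨
    (∃ r c, N.φ (G.rev (G.bd i)) = .bo r c ∧ ((r, c) ∈ S ∨ (r = 0 ∧ c < n - k)) ∧
      (r, c + 1) ∉ S ∧ (i : ℕ) = k - 1 - r + c + 1) := by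
  have hc : color (N.φ (G.rev (G.bd i))) ≠ none := N.color_ne_none fun j h =>
    G.kind_rev_bd i j ((G.kind_eq_inl_iff _ _).2 h)
  have h := N.rev _ hc
  have hv := N.valid (G.rev (G.bd i))
  rw [G.rev_rev, N.bd] at h
  cases hx : N.φ (G.rev (G.bd i)) with
  | wo r c => rw [hx] at h hv; exact Or.inl ⟨r, c, by grind [rv, Valid]⟩
  | bo r c => rw [hx] at h hv; exact Or.inr ⟨r, c, by grind [rv, Valid]⟩
  | _ => rw [hx] at h hc; simp [rv, color] at h hc

theorem faceNext_of_color (N : DartNaming G (Valid n k S) (rv k S) (rt S)) {d : G.Dart}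
    (h : color (N.φ (G.rev d)) ≠ none) : N.φ (G.faceNext d) = rtInv S (N.φ (G.rev d)) := by
  obtain ⟨c, hc⟩ := Option.ne_none_iff_exists'.1 h
  rw [PlabicMap.faceNext, N.kind _ c hc]
  exact N.rot_symm h

theorem faceNext_of_bd {d : G.Dart} {i : Fin n} (h : G.rev d = G.bd i) :
    G.faceNext d = G.bd ((finRotate n).symm i) := by
  rw [PlabicMap.faceNext, (G.kind_eq_inl_iff _ i).2 h]

/-- The box of the face to the left of a dart. -/
noncomputable def faceBox (N : DartNaming G (Valid n k S) (rv k S) (rt S)) (d : G.Dart) :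
    Option (ℕ × ℕ) :=
  match N.φ d with
  | .bd _ => rightFaceBox S (N.φ (G.rev d))
  | x => leftFaceBox S x

theorem faceBox_of_color (N : DartNaming G (Valid n k S) (rv k S) (rt S)) {d : G.Dart}
    {x : BridgeDart} (h : N.φ d = x) (hx : color x ≠ none) : N.faceBox d = leftFaceBox S x := by
  rw [faceBox, h]
  cases x <;> simp_all [color]

theorem faceBox_bd (N : DartNaming G (Valid n k S) (rv k S) (rt S)) (i : Fin n) :
    N.faceBox (G.bd i) = rightFaceBox S (N.φ (G.rev (G.bd i))) := by
  rw [faceBox, N.bd]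

/-- The face along the boundary arc that starts at `i` is enclosed by the last bridge with number
`i`, and is the outer face if there is no such bridge. With `isLast_faceBox_of_rev`, which looks at
an arc from its other end, this shows that passing along the boundary circle keeps the box. -/
theorem isLast_faceBox_bd (hS : IsDiagramIn n k S)
    (N : DartNaming G (Valid n k S) (rv k S) (rt S)) (i : Fin n) :
    IsLastOnDiagonal k S i (N.faceBox (G.bd i)) := by
  have h1 := hS.row_lt
  have h2 := hS.col_lt
  have h3 := hS.lower
  have h4 := hS.pos
  have h5 := hS.lt
  rw [N.faceBox_bd]
  rcases N.rev_bd_cases i with ⟨r, c, h, hv, hn, hi⟩ | ⟨r, c, h, hv, hn, hi⟩ <;> rw [h]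
  · simp only [rightFaceBox]
    split_ifs with hrc
    · exact ⟨hrc, fun h' => hn (h3 _ _ _ _ h' (by simp) (by simp)), hi.symm⟩
    · obtain ⟨rfl, hr⟩ := hv.resolve_left hrc
      intro r' c' h' e
      have := h1 _ _ h'
      exact hrc (h3 _ _ _ _ h' (by omega) (by omega))
  · rcases r with _ | r
    · intro r' c' h' e
      have := h1 _ _ h'
      exact hn (h3 _ _ _ _ h' (by omega) (by omega))
    · have hrc : (r + 1, c) ∈ S := hv.resolve_right (by simp)
      have := h1 _ _ hrc
      exact ⟨h3 _ _ _ _ hrc (by simp) (by simp), hn, by dsimp only; omega⟩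

theorem isLast_faceBox_of_rev (hS : IsDiagramIn n k S)
    (N : DartNaming G (Valid n k S) (rv k S) (rt S)) {d : G.Dart} {i : Fin n}
    (hd : G.rev d = G.bd i) :
    IsLastOnDiagonal k S ((finRotate n).symm i : Fin n) (N.faceBox d) := by
  have h1 := hS.row_lt
  have h2 := hS.col_lt
  have h3 := hS.lower
  have h4 := hS.pos
  have h5 := hS.lt
  have hd' : d = G.rev (G.bd i) := by rw [← hd, G.rev_rev]
  subst hd'
  -- The arc before vertex 0 starts at `n - 1`. A box in the rectangle has diagonal number at most
  -- `n - 2`, so this arc belongs to the outer face.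
  rw [val_finRotate_symm]
  rcases N.rev_bd_cases i with ⟨r, c, h, hv, hn, hi⟩ | ⟨r, c, h, hv, hn, hi⟩ <;>
    rw [N.faceBox_of_color h (by simp [color])]
  · rcases c with _ | c
    · intro r' c' h' e
      have a1 := h1 _ _ h'
      have a2 := h2 _ _ h'
      have a3 : r < k := by rcases hv with h | h; exacts [h1 _ _ h, h.2]
      refine hn (h3 _ _ _ _ h' ?_ ?_) <;> split_ifs at e <;> omega
    · have hrc : (r, c + 1) ∈ S := hv.resolve_right (by simp)
      have := h1 _ _ hrc
      exact ⟨h3 _ _ _ _ hrc (by simp) (by simp), hn, by dsimp only; split_ifs <;> omega⟩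
  · rw [if_neg (by omega)]
    simp only [leftFaceBox]
    split_ifs with hrc
    · exact ⟨hrc, fun h' => hn (h3 _ _ _ _ h' (by simp) (by simp)), by dsimp only; omega⟩
    · obtain ⟨rfl, hr⟩ := hv.resolve_left hrc
      intro r' c' h' e
      have := h1 _ _ h'
      exact hrc (h3 _ _ _ _ h' (by omega) (by omega))

/-- At an internal vertex this is a comparison of the box tables with `rtInv S` after `rv k S`. At
the boundary both darts see the last box on the same diagonal. -/
theorem faceBox_faceNext (hS : IsDiagramIn n k S)
    (N : DartNaming G (Valid n k S) (rv k S) (rt S)) (d : G.Dart) :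
    N.faceBox (G.faceNext d) = N.faceBox d := by
  have h3 := hS.lower
  have hv := N.valid d
  by_cases hr : color (N.φ (G.rev d)) = none
  · have : ∃ i, G.rev d = G.bd i := by
      by_contra! h
      exact N.color_ne_none h hr
    obtain ⟨i, hi⟩ := this
    rw [faceNext_of_bd hi]
    exact (N.isLast_faceBox_bd hS _).unique hS (N.isLast_faceBox_of_rev hS hi)
  · have hf := N.faceNext_of_color hr
    by_cases hd : color (N.φ d) = none
    · have : ∃ i, d = G.bd i := by
        by_contra! h
        exact N.color_ne_none h hd
      obtain ⟨i, rfl⟩ := this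
      rw [N.faceBox_bd]
      rcases N.rev_bd_cases i with ⟨r, c, h, hv, hn, hi⟩ | ⟨r, c, h, hv, hn, hi⟩ <;> rw [h] at hf ⊢
      · rw [rtInv] at hf
        rw [N.faceBox_of_color hf (by split_ifs <;> simp [color])]
        rcases c with _ | c <;> grind [leftFaceBox, rightFaceBox, leftBox]
      · rcases r with _ | r <;> rw [rtInv] at hf
        · rw [N.faceBox_of_color hf (by split_ifs <;> simp [color])]
          by_cases h0 : (0, c) ∈ S <;> cases c <;>
            simp [leftFaceBox, rightFaceBox, nwBox, upBox, h0]
        · rw [N.faceBox_of_color hf (by simp [color])]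
          grind [leftFaceBox, rightFaceBox, nwBox, upBox]
    · have hrev := N.rev d hd
      rw [hrev] at hr hf
      cases hx : N.φ d with
      | bd i => rw [hx] at hd; simp [color] at hd
      | wo r c =>
        rw [N.faceBox_of_color hx (by simp [color])]
        rw [hx] at hr hf
        have h' : (r + 1, c) ∈ S := by
          by_contra h'; simp [rv, h', color] at hr
        rw [rv, if_pos h', rtInv] at hf
        rw [N.faceBox_of_color hf (by simp [color])]
        cases c <;> rfl
      | wi r c =>
        rw [N.faceBox_of_color hx (by simp [color])]
        rw [hx] at hf hv
        have h' : (r, c) ∈ S := h3 _ _ _ _ hv (by simp) (by simp)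
        cases r <;> simp only [rv, rtInv, h', if_true] at hf <;>
          rw [N.faceBox_of_color hf (by simp [color])] <;> cases c <;> rfl
      | wb r c =>
        rw [N.faceBox_of_color hx (by simp [color])]
        rw [hx] at hf hv
        rw [N.faceBox_of_color hf (by simp [color, rv, rtInv])]
        have h' : (r, c) ∈ S := hv
        simp [rv, rtInv, leftFaceBox, h']
      | bo r c =>
        rw [N.faceBox_of_color hx (by simp [color])]
        rw [hx] at hr hf
        have h' : (r, c + 1) ∈ S := by
          by_contra h'; simp [rv, h', color] at hr
        rw [rv, if_pos h', rtInv] at hf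
        have h0 : (r, c) ∈ S := h3 _ _ _ _ h' (by simp) (by simp)
        rw [N.faceBox_of_color hf (by simp [color])]
        simp [leftFaceBox, leftBox, h0]
      | bi r c =>
        rw [N.faceBox_of_color hx (by simp [color])]
        rw [hx] at hf hv
        have h' : (r, c) ∈ S := h3 _ _ _ _ hv (by simp) (by simp)
        simp only [rv, rtInv, h', if_true] at hf
        rw [N.faceBox_of_color hf (by simp [color])]
        rfl
      | bb r c =>
        rw [N.faceBox_of_color hx (by simp [color])]
        rw [hx] at hf
        cases c <;> simp only [rv, rtInv] at hf <;>
          rw [N.faceBox_of_color hf (by simp [color])] <;> cases r <;> rfl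

end DartNaming

/-! ### Faces correspond to boxes and one outer face -/

namespace DartNaming

open BridgeDart

variable {n k : ℕ} {G : PlabicMap n} {S : Set (ℕ × ℕ)}

theorem faceBox_mem (hS : IsDiagramIn n k S) (N : DartNaming G (Valid n k S) (rv k S) (rt S))
    {d : G.Dart} {b : ℕ × ℕ} (h : N.faceBox d = some b) : b ∈ S := by
  have h3 := hS.lower
  have hv := N.valid d
  obtain ⟨r, c⟩ := b
  cases hx : N.φ d with
  | bd i =>
    obtain ⟨hi, rfl⟩ := N.eq_bd hx
    have := N.isLast_faceBox_bd hS ⟨i, hi⟩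
    rw [h] at this
    exact this.1
  | wo r' c' =>
    rw [N.faceBox_of_color hx (by simp [color])] at h
    rw [hx] at hv
    cases c' <;> simp [leftFaceBox, leftBox, Valid] at h hv
    exact h3 _ _ _ _ hv (by omega) (by omega)
  | wi r' c' =>
    rw [N.faceBox_of_color hx (by simp [color])] at h
    rw [hx] at hv
    cases r' <;> simp [leftFaceBox, upBox, Valid] at h hv
    exact h3 _ _ _ _ hv (by omega) (by omega)
  | wb r' c' =>
    rw [N.faceBox_of_color hx (by simp [color])] at h
    rw [hx] at hv
    simp [leftFaceBox, Valid] at h hv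
    exact h3 _ _ _ _ hv (by omega) (by omega)
  | bo r' c' =>
    rw [N.faceBox_of_color hx (by simp [color])] at h
    simp only [leftFaceBox] at h
    split_ifs at h with h'
    rwa [← Option.some.inj h]
  | bi r' c' =>
    rw [N.faceBox_of_color hx (by simp [color])] at h
    rw [hx] at hv
    simp [leftFaceBox, Valid] at h hv
    exact h3 _ _ _ _ hv (by omega) (by omega)
  | bb r' c' =>
    rw [N.faceBox_of_color hx (by simp [color])] at h
    rw [hx] at hv
    cases r' <;> cases c' <;> simp [leftFaceBox, nwBox, Valid] at h hv
    exact h3 _ _ _ _ hv (by omega) (by omega)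

theorem leftFace_faceNext (d : G.Dart) : G.leftFace (G.faceNext d) = G.leftFace d :=
  (Quot.sound (r := fun d e : G.Dart => G.faceNext d = e) rfl).symm

theorem leftFace_eq_of_next (N : DartNaming G (Valid n k S) (rv k S) (rt S)) {d e : G.Dart}
    {x y : BridgeDart} (hd : N.φ d = x) (he : N.φ e = y) (hx : color x ≠ none)
    (hx' : color (rv k S x) ≠ none) (h : rtInv S (rv k S x) = y) :
    G.leftFace d = G.leftFace e := by
  have hr : N.φ (G.rev d) = rv k S x := by rw [N.rev d (by rwa [hd]), hd]
  rw [← leftFace_faceNext d]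
  congr 1
  apply N.inj
  rw [N.faceNext_of_color (by rwa [hr]), hr, h, he]

theorem leftFace_bd_eq (N : DartNaming G (Valid n k S) (rv k S) (rt S)) {i : Fin n}
    {e : G.Dart} {x y : BridgeDart} (he : N.φ e = y) (h : N.φ (G.rev (G.bd i)) = x)
    (hx : color x ≠ none) (hxy : rtInv S x = y) : G.leftFace (G.bd i) = G.leftFace e := by
  rw [← leftFace_faceNext]
  congr 1
  apply N.inj
  rw [N.faceNext_of_color (by rwa [h]), h, hxy, he]

theorem leftFace_eq_bd (N : DartNaming G (Valid n k S) (rv k S) (rt S)) {d : G.Dart}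
    {x : BridgeDart} (hd : N.φ d = x) (hx : color x ≠ none) {i j : ℕ}
    (h : rv k S x = .bd i) (hj : j < n) (hij : j = if i = 0 then n - 1 else i - 1) :
    G.leftFace d = G.leftFace (G.bd ⟨j, hj⟩) := by
  have hr : N.φ (G.rev d) = .bd i := by rw [N.rev d (by rwa [hd]), hd, h]
  obtain ⟨hi, hr⟩ := N.eq_bd hr
  rw [← leftFace_faceNext d, faceNext_of_bd hr]
  congr 2
  ext
  rw [val_finRotate_symm]
  exact hij.symm

/-- The sides of the face are `wb r c`, `bo r c`, `wo r (c + 1)`, `bb (r + 1) (c + 1)`, `wi (r + 1)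
c`, `bi r c`, in this cyclic order, as far as they exist. The boundary may cut this hexagon open
between `bo r c` and `bi r c`. So the first sides are reached from `wb r c` going forwards, and
`bb`, `wi`, `bi` lead on to `wb r c`; neither chain has to pass through the boundary. -/
theorem leftFace_eq_of_some (hS : IsDiagramIn n k S)
    (N : DartNaming G (Valid n k S) (rv k S) (rt S)) {d e : G.Dart} {r c : ℕ}
    (hd : N.faceBox d = some (r, c)) (he : N.φ e = .wb r c) : G.leftFace d = G.leftFace e := by
  have h3 := hS.lower
  have hrc : (r, c) ∈ S := N.faceBox_mem hS hd
  have hv := N.valid d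
  obtain ⟨f, hf⟩ := N.exists_dart (x := .bo r c) (Or.inl hrc)
  have hfe : G.leftFace f = G.leftFace e :=
    (N.leftFace_eq_of_next he hf (by simp [color]) (by simp [rv, color]) (by simp [rv, rtInv])).symm
  have hbi : ∀ g, N.φ g = .bi r c → G.leftFace g = G.leftFace e := fun g hg =>
    N.leftFace_eq_of_next hg he (by simp [color]) (by simp [rv, color]) (by simp [rv, rtInv, hrc])
  cases hx : N.φ d with
  | bd i =>
    obtain ⟨hi, rfl⟩ := N.eq_bd hx
    rw [N.faceBox_bd] at hd
    rcases N.rev_bd_cases ⟨i, hi⟩ with ⟨r', c', h, hv, hn, hi'⟩ | ⟨r', c', h, hv, hn, hi'⟩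
    · rw [h] at hd
      simp only [rightFaceBox] at hd
      split_ifs at hd with h'
      obtain ⟨rfl, rfl⟩ := Prod.mk.inj (Option.some.inj hd)
      exact N.leftFace_bd_eq he h (by simp [color]) (by simp [rtInv, h'])
    · rw [h] at hd
      rcases r' with _ | r' <;> simp [rightFaceBox, upBox] at hd
      obtain ⟨rfl, rfl⟩ := hd
      have hv' : (r' + 1, c') ∈ S := hv.resolve_right (by simp)
      obtain ⟨g, hg⟩ := N.exists_dart (x := .bi r' c') hv'
      exact (N.leftFace_bd_eq hg h (by simp [color]) (by simp [rtInv])).trans (hbi g hg)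
  | wo r' c' =>
    rw [N.faceBox_of_color hx (by simp [color])] at hd
    rw [hx] at hv
    cases c' <;> simp [leftFaceBox, leftBox, Valid] at hd hv
    obtain ⟨rfl, rfl⟩ := hd
    exact (N.leftFace_eq_of_next hf hx (by simp [color]) (by simp [rv, color, hv])
      (by simp [rv, rtInv, hv])).symm.trans hfe
  | wi r' c' =>
    rw [N.faceBox_of_color hx (by simp [color])] at hd
    rw [hx] at hv
    rcases r' with _ | r' <;> simp [leftFaceBox, upBox, Valid] at hd hv
    obtain ⟨rfl, rfl⟩ := hd
    obtain ⟨g, hg⟩ := N.exists_dart (x := .bi r' c') (h3 _ _ _ _ hv (by simp) (by simp))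
    exact (N.leftFace_eq_of_next hx hg (by simp [color]) (by simp [rv, color])
      (by simp [rv, rtInv])).trans (hbi g hg)
  | wb r' c' =>
    rw [N.faceBox_of_color hx (by simp [color])] at hd
    simp [leftFaceBox] at hd
    obtain ⟨rfl, rfl⟩ := hd
    rw [N.inj (hx.trans he.symm)]
  | bo r' c' =>
    rw [N.faceBox_of_color hx (by simp [color])] at hd
    simp only [leftFaceBox] at hd
    split_ifs at hd with h'
    obtain ⟨rfl, rfl⟩ := Prod.mk.inj (Option.some.inj hd)
    rw [N.inj (hx.trans hf.symm), hfe]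
  | bi r' c' =>
    rw [N.faceBox_of_color hx (by simp [color])] at hd
    simp [leftFaceBox] at hd
    obtain ⟨rfl, rfl⟩ := hd
    exact hbi d hx
  | bb r' c' =>
    rw [N.faceBox_of_color hx (by simp [color])] at hd
    rw [hx] at hv
    rcases r' with _ | r' <;> rcases c' with _ | c' <;> simp [leftFaceBox, nwBox, Valid] at hd hv
    obtain ⟨rfl, rfl⟩ := hd
    obtain ⟨g, hg⟩ := N.exists_dart (x := .bi r' c') (h3 _ _ _ _ hv (by simp) (by simp))
    obtain ⟨g', hg'⟩ := N.exists_dart (x := .wi (r' + 1) c') hv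
    exact (N.leftFace_eq_of_next hx hg' (by simp [color]) (by simp [rv, color])
      (by simp [rv, rtInv])).trans ((N.leftFace_eq_of_next hg' hg (by simp [color])
        (by simp [rv, color]) (by simp [rv, rtInv])).trans (hbi g hg))

/-- The outer face is followed down the first column, past bridges as long as the rows are nonempty
and past white lollipops afterwards, until it reaches the arc before vertex 0. Here `m` is the
number of rows below `r`. -/
theorem leftFace_wo_zero (hS : IsDiagramIn n k S)
    (N : DartNaming G (Valid n k S) (rv k S) (rt S)) (m : ℕ) {r : ℕ} {d : G.Dart}
    (hm : r + m + 1 = k) (hd : N.φ d = .wo r 0) :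
    G.leftFace d = G.leftFace (G.bd ⟨n - 1, by have := hS.lt; omega⟩) := by
  have h3 := hS.lower
  have h4 := hS.lt
  induction m generalizing r d with
  | zero =>
    have hr : (r + 1, 0) ∉ S := fun h => by have := hS.row_lt _ _ h; omega
    exact N.leftFace_eq_bd hd (by simp [color]) (by simp [rv, hr]; rfl) _ (by simp; omega)
  | succ m ih =>
    obtain ⟨e, he⟩ := N.exists_dart (x := .wo (r + 1) 0) (Or.inr ⟨rfl, by omega⟩)
    rw [← ih (by omega) he]
    by_cases hr : (r + 1, 0) ∈ S
    · obtain ⟨f, hf⟩ := N.exists_dart (x := .bb (r + 1) 0) hr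
      exact (N.leftFace_eq_of_next hd hf (by simp [color]) (by simp [rv, color, hr])
        (by simp [rv, rtInv, hr])).trans (N.leftFace_eq_of_next hf he (by simp [color])
          (by simp [rv, color]) (by simp [rv, rtInv]))
    · have hr' : (r + 1 + 1, 0) ∉ S := fun h => hr (h3 _ _ _ _ h (by simp) (by simp))
      have hlt : k - 1 - (r + 1) < n := by omega
      rw [N.leftFace_eq_bd (i := k - 1 - r) (j := k - 1 - (r + 1)) hd (by simp [color])
        (by simp [rv, hr]) hlt (by rw [if_neg (by omega)]; omega)]
      exact N.leftFace_bd_eq he (N.rev_bd (i := ⟨k - 1 - (r + 1), hlt⟩) (x := .wo (r + 1) 0)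
        (Or.inr ⟨rfl, by omega⟩) (by simp [color]) (by simp [rv, hr'])) (by simp [color])
        (by simp [rtInv, hr])

/-- The outer face is followed to the left along the top of the first row, past black lollipops and
then past bridges, to `wo 0 0`, where `leftFace_wo_zero` takes over. -/
theorem leftFace_top (hS : IsDiagramIn n k S)
    (N : DartNaming G (Valid n k S) (rv k S) (rt S)) (c : ℕ) :
    (∀ d, N.φ d = .bb 0 c → G.leftFace d = G.leftFace (G.bd ⟨n - 1, by have := hS.lt; omega⟩)) ∧
    (∀ d, N.φ d = .bo 0 c → (0, c) ∉ S →
      G.leftFace d = G.leftFace (G.bd ⟨n - 1, by have := hS.lt; omega⟩)) := by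
  have h3 := hS.lower
  have h4 := hS.lt
  have h5 := hS.pos
  obtain ⟨e, he⟩ := N.exists_dart (x := .wo 0 0) (Or.inr ⟨rfl, by omega⟩)
  have h0 := N.leftFace_wo_zero hS (k - 1) (by omega) he
  induction c with
  | zero =>
    constructor
    · intro d hd
      rw [← h0]
      exact N.leftFace_eq_of_next hd he (by simp [color]) (by simp [rv, color])
        (by simp [rv, rtInv])
    · intro d hd h
      have h1 : (0, 1) ∉ S := fun h' => h (h3 _ _ _ _ h' (by simp) (by simp))
      have h2 : (1, 0) ∉ S := fun h' => h (h3 _ _ _ _ h' (by simp) (by simp))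
      have hlt : k - 1 < n := by omega
      rw [← h0, N.leftFace_eq_bd (j := k - 1) hd (by simp [color]) (by simp [rv, h1]; rfl) hlt
        (by simp)]
      exact N.leftFace_bd_eq he (N.rev_bd (i := ⟨k - 1, hlt⟩) (x := .wo 0 0)
        (Or.inr ⟨rfl, by omega⟩) (by simp [color]) (by simp [rv, h2])) (by simp [color])
        (by simp [rtInv, h])
  | succ c ih =>
    constructor
    · intro d hd
      have hv : (0, c + 1) ∈ S := by simpa [hd, Valid] using N.valid d
      have hv' : (0, c) ∈ S := h3 _ _ _ _ hv (by simp) (by simp)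
      obtain ⟨f, hf⟩ := N.exists_dart (x := .wi 0 c) hv
      obtain ⟨g, hg⟩ := N.exists_dart (x := .bb 0 c) hv'
      rw [← ih.1 g hg]
      exact (N.leftFace_eq_of_next hd hf (by simp [color]) (by simp [rv, color])
        (by simp [rv, rtInv])).trans (N.leftFace_eq_of_next hf hg (by simp [color])
          (by simp [rv, color]) (by simp [rv, rtInv, hv']))
    · intro d hd h
      have hv : c + 1 < n - k := by simpa [hd, Valid, h] using N.valid d
      have h1 : (0, c + 1 + 1) ∉ S := fun h' => h (h3 _ _ _ _ h' (by simp) (by simp))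
      have hlt : k - 1 + c + 1 < n := by omega
      rw [N.leftFace_eq_bd (j := k - 1 + c + 1) hd (by simp [color]) (by simp [rv, h1]; rfl) hlt
        (by simp; omega)]
      have hrev := N.rev_bd (i := ⟨k - 1 + c + 1, hlt⟩) (x := .bo 0 c)
        (Or.inr ⟨rfl, by omega⟩) (by simp [color]) (by simp [rv, h])
      by_cases hc : (0, c) ∈ S
      · obtain ⟨g, hg⟩ := N.exists_dart (x := .bb 0 c) hc
        rw [← ih.1 g hg]
        exact N.leftFace_bd_eq hg hrev (by simp [color]) (by simp [rtInv, hc])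
      · obtain ⟨g, hg⟩ := N.exists_dart (x := .bo 0 c) (Or.inr ⟨rfl, by omega⟩)
        rw [← ih.2 g hg hc]
        exact N.leftFace_bd_eq hg hrev (by simp [color]) (by simp [rtInv, hc])

theorem leftFace_eq_of_none (hS : IsDiagramIn n k S)
    (N : DartNaming G (Valid n k S) (rv k S) (rt S)) {d : G.Dart} (hd : N.faceBox d = none) :
    G.leftFace d = G.leftFace (G.bd ⟨n - 1, by have := hS.lt; omega⟩) := by
  have h3 := hS.lower
  have hv := N.valid d
  have hwo : ∀ r g, r < k → N.φ g = .wo r 0 →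
      G.leftFace g = G.leftFace (G.bd ⟨n - 1, by have := hS.lt; omega⟩) := fun r g hr hg =>
    N.leftFace_wo_zero hS (k - 1 - r) (by omega) hg
  cases hx : N.φ d with
  | bd i =>
    obtain ⟨hi, rfl⟩ := N.eq_bd hx
    rw [N.faceBox_bd] at hd
    rcases N.rev_bd_cases ⟨i, hi⟩ with ⟨r, c, h, hv, hn, hi'⟩ | ⟨r, c, h, hv, hn, hi'⟩
    · rw [h] at hd
      simp only [rightFaceBox] at hd
      split_ifs at hd with h'
      obtain ⟨rfl, hr⟩ := hv.resolve_left h'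
      obtain ⟨g, hg⟩ := N.exists_dart (x := .wo r 0) (Or.inr ⟨rfl, hr⟩)
      rw [← hwo r g hr hg]
      exact N.leftFace_bd_eq hg h (by simp [color]) (by simp [rtInv, h'])
    · rw [h] at hd
      rcases r with _ | r <;> simp [rightFaceBox, upBox] at hd
      by_cases hc : (0, c) ∈ S
      · obtain ⟨g, hg⟩ := N.exists_dart (x := .bb 0 c) hc
        rw [← (N.leftFace_top hS c).1 g hg]
        exact N.leftFace_bd_eq hg h (by simp [color]) (by simp [rtInv, hc])
      · obtain ⟨g, hg⟩ := N.exists_dart (x := .bo 0 c) hv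
        rw [← (N.leftFace_top hS c).2 g hg hc]
        exact N.leftFace_bd_eq hg h (by simp [color]) (by simp [rtInv, hc])
  | wo r c =>
    rw [N.faceBox_of_color hx (by simp [color])] at hd
    rw [hx] at hv
    rcases c with _ | c <;> simp [leftFaceBox, leftBox, Valid] at hd hv
    exact hwo r d (hv.elim (hS.row_lt _ _) id) hx
  | wi r c =>
    rw [N.faceBox_of_color hx (by simp [color])] at hd
    rw [hx] at hv
    rcases r with _ | r <;> simp [leftFaceBox, upBox, Valid] at hd hv
    have hv' : (0, c) ∈ S := h3 _ _ _ _ hv (by simp) (by simp)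
    obtain ⟨g, hg⟩ := N.exists_dart (x := .bb 0 c) hv'
    rw [← (N.leftFace_top hS c).1 g hg]
    exact N.leftFace_eq_of_next hx hg (by simp [color]) (by simp [rv, color])
      (by simp [rv, rtInv, hv'])
  | wb r c =>
    rw [N.faceBox_of_color hx (by simp [color])] at hd
    simp [leftFaceBox] at hd
  | bo r c =>
    rw [N.faceBox_of_color hx (by simp [color])] at hd
    simp only [leftFaceBox] at hd
    split_ifs at hd with h'
    rw [hx] at hv
    obtain ⟨rfl, hr⟩ := hv.resolve_left h'
    exact (N.leftFace_top hS c).2 d hx h'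
  | bi r c =>
    rw [N.faceBox_of_color hx (by simp [color])] at hd
    simp [leftFaceBox] at hd
  | bb r c =>
    rw [N.faceBox_of_color hx (by simp [color])] at hd
    rw [hx] at hv
    rcases r with _ | r
    · exact (N.leftFace_top hS c).1 d hx
    · rcases c with _ | c <;> simp [leftFaceBox, nwBox] at hd
      have hr := hS.row_lt _ _ hv
      obtain ⟨g, hg⟩ := N.exists_dart (x := .wo (r + 1) 0) (Or.inr ⟨rfl, hr⟩)
      rw [← hwo _ g hr hg]
      exact N.leftFace_eq_of_next hx hg (by simp [color]) (by simp [rv, color])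
        (by simp [rv, rtInv])

/-- The box of a face. -/
noncomputable def boxOfFace (hS : IsDiagramIn n k S)
    (N : DartNaming G (Valid n k S) (rv k S) (rt S)) : G.Face → Option (ℕ × ℕ) :=
  Quot.lift N.faceBox (by rintro d _ rfl; exact (N.faceBox_faceNext hS d).symm)

theorem boxOfFace_leftFace (hS : IsDiagramIn n k S)
    (N : DartNaming G (Valid n k S) (rv k S) (rt S)) (d : G.Dart) :
    N.boxOfFace hS (G.leftFace d) = N.faceBox d := rfl

theorem boxOfFace_injective (hS : IsDiagramIn n k S)
    (N : DartNaming G (Valid n k S) (rv k S) (rt S)) : Function.Injective (N.boxOfFace hS) := by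
  rintro ⟨d⟩ ⟨e⟩ (h : N.faceBox d = N.faceBox e)
  change G.leftFace d = G.leftFace e
  rcases hb : N.faceBox e with _ | ⟨r, c⟩
  · rw [N.leftFace_eq_of_none hS hb, N.leftFace_eq_of_none hS (h.trans hb)]
  · obtain ⟨f, hf⟩ := N.exists_dart (x := .wb r c) (N.faceBox_mem hS hb)
    rw [N.leftFace_eq_of_some hS hb hf, N.leftFace_eq_of_some hS (h.trans hb) hf]

theorem boxOfFace_mem (hS : IsDiagramIn n k S)
    (N : DartNaming G (Valid n k S) (rv k S) (rt S)) {F : G.Face} {b : ℕ × ℕ}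
    (h : N.boxOfFace hS F = some b) : b ∈ S := by
  obtain ⟨d⟩ := F
  exact N.faceBox_mem hS h

theorem exists_boxOfFace (hS : IsDiagramIn n k S)
    (N : DartNaming G (Valid n k S) (rv k S) (rt S)) {b : ℕ × ℕ} (hb : b ∈ S) :
    ∃ F, N.boxOfFace hS F = some b := by
  obtain ⟨f, hf⟩ := N.exists_dart (x := .wb b.1 b.2) hb
  exact ⟨G.leftFace f, by
    rw [N.boxOfFace_leftFace, N.faceBox_of_color hf (by simp [color])]; rfl⟩

/-- The faces on the boundary are those of the last boxes of the diagonals, seen from the arc with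
the number of the diagonal, and the outer face, for which the condition is vacuous. -/
theorem isBoundaryFace_iff (hS : IsDiagramIn n k S)
    (N : DartNaming G (Valid n k S) (rv k S) (rt S)) (F : G.Face) :
    G.IsBoundaryFace F ↔ ∀ r c, N.boxOfFace hS F = some (r, c) → (r + 1, c + 1) ∉ S := by
  constructor
  · rintro ⟨i, rfl⟩ r c h
    have := N.isLast_faceBox_bd hS i
    rw [← N.boxOfFace_leftFace hS, h] at this
    exact this.2.1
  · intro h
    rcases hb : N.boxOfFace hS F with _ | ⟨r, c⟩
    · obtain ⟨d⟩ := F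
      exact ⟨_, (N.leftFace_eq_of_none hS hb).symm⟩
    · have hrc := N.boxOfFace_mem hS hb
      have h1 := hS.row_lt _ _ hrc
      have h2 := hS.col_lt _ _ hrc
      have h4 := hS.lt
      refine ⟨⟨k - 1 - r + c, by omega⟩, N.boxOfFace_injective hS ?_⟩
      rw [hb]
      exact (N.isLast_faceBox_bd hS _).unique hS ⟨hrc, h r c hb, rfl⟩

theorem exists_boxOfFace_none (hS : IsDiagramIn n k S)
    (N : DartNaming G (Valid n k S) (rv k S) (rt S)) : ∃ F, N.boxOfFace hS F = none := by
  have h4 := hS.lt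
  refine ⟨G.leftFace (G.bd ⟨n - 1, by omega⟩), ?_⟩
  rw [N.boxOfFace_leftFace]
  refine (N.isLast_faceBox_bd hS _).unique hS ?_
  intro r c h
  have h1 := hS.row_lt _ _ h
  have h2 := hS.col_lt _ _ h
  dsimp only
  omega

end DartNaming

/-! ### Trips and their ends -/

/-- The face of the box `X` is to the left of the trip that ends at `j`. -/
def IsLeftBox (k j : ℕ) : Option (ℕ × ℕ) → Prop
  | none => j < k
  | some b => (j < k ∧ (b.1 + j + 1 < k ∨ b.2 + k ≤ b.1 + j)) ∨
      (k ≤ j ∧ j ≤ k + b.2 ∧ b.2 + k ≤ b.1 + j)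

/-- There is no lollipop at `j`. -/
def IsTouched (k : ℕ) (S : Set (ℕ × ℕ)) (j : ℕ) : Prop :=
  (j < k ∧ (k - 1 - j, 0) ∈ S) ∨ (k ≤ j ∧ (0, j - k) ∈ S)

namespace BridgeDart

/-- The next dart on a trip, after a dart with the reverse `x`. -/
noncomputable def turn (S : Set (ℕ × ℕ)) (x : BridgeDart) : Option BridgeDart :=
  match color x with
  | some .white => some (rtInv S x)
  | some .black => some (rt S x)
  | none => none

/-- The end of the trip of a dart that does not start at the boundary. -/
def tripEnd (k : ℕ) : BridgeDart → ℕ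
  | wo r c => k - 1 - r + c
  | wi r _ => k - 1 - r
  | wb _ c => k + c
  | bo r c => k - 1 - r + c + 1
  | bi _ c => k + c
  | bb r _ => k - 1 - r
  | bd i => i

open Classical in
/-- The end of the trip of the reverse of a dart that does not start at the boundary. -/
noncomputable def revTripEnd (k : ℕ) (S : Set (ℕ × ℕ)) : BridgeDart → ℕ
  | wo r c => if (r, c) ∈ S then k + c else k - 1 - r
  | wi r c => k - 1 - r + c + 1
  | wb r _ => k - 1 - r
  | bo r c => if (r, c) ∈ S then k - 1 - r else k + c
  | bi r c => k - 1 - r + c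
  | bb _ c => k + c
  | bd _ => 0

variable {n k : ℕ} {S : Set (ℕ × ℕ)}

/-- A trip has its left side on the left. Lollipops must be excluded, since both sides of their edge
are the same face. -/
theorem isLeftBox_leftFaceBox (hS : IsDiagramIn n k S) {x : BridgeDart} (hv : Valid n k S x)
    (hx : color x ≠ none) (hj : IsTouched k S (tripEnd k x)) :
    IsLeftBox k (tripEnd k x) (leftFaceBox S x) ∧
      ¬ IsLeftBox k (tripEnd k x) (rightFaceBox S x) := by
  have hr := hS.row_lt
  cases x with
  | bd => exact absurd rfl hx
  | wo r c =>
    have h0 : r < k := hv.elim (hr _ _) (·.2)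
    by_cases h : (r, c) ∈ S
    · rcases c with _ | c <;>
        simp [h, tripEnd, leftFaceBox, rightFaceBox, leftBox, IsLeftBox] <;> omega
    · obtain ⟨rfl, -⟩ := hv.resolve_left h
      refine absurd ?_ h
      rcases hj with ⟨h1, h2⟩ | ⟨h1, h2⟩ <;> simp only [tripEnd] at h1 h2
      · rwa [show k - 1 - (k - 1 - r + 0) = r by omega] at h2
      · omega
  | wi r c =>
    have h0 := hr _ _ hv
    rcases r with _ | r <;>
      simp [tripEnd, leftFaceBox, rightFaceBox, upBox, IsLeftBox] <;> omega
  | wb r c =>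
    have h0 := hr _ _ hv
    rcases r with _ | r <;> rcases c with _ | c <;>
      simp [tripEnd, leftFaceBox, rightFaceBox, nwBox, IsLeftBox] <;> omega
  | bo r c =>
    by_cases h : (r, c) ∈ S
    · have h0 := hr _ _ h
      rcases r with _ | r <;>
        simp [h, tripEnd, leftFaceBox, rightFaceBox, upBox, IsLeftBox] <;> omega
    · obtain ⟨rfl, -⟩ := hv.resolve_left h
      have h0 := hS.pos
      refine absurd ?_ h
      rcases hj with ⟨h1, h2⟩ | ⟨h1, h2⟩ <;> simp only [tripEnd] at h1 h2
      · omega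
      · rwa [show k - 1 - 0 + c + 1 - k = c by omega] at h2
  | bi r c =>
    have h0 := hr _ _ hv
    rcases c with _ | c <;>
      simp [tripEnd, leftFaceBox, rightFaceBox, leftBox, IsLeftBox] <;> omega
  | bb r c =>
    have h0 := hr _ _ hv
    rcases r with _ | r <;> rcases c with _ | c <;>
      simp [tripEnd, leftFaceBox, rightFaceBox, nwBox, IsLeftBox] <;> omega

theorem isLeftBox_rightFaceBox (hS : IsDiagramIn n k S) {x : BridgeDart} (hv : Valid n k S x)
    (hx : color x ≠ none) (hj : IsTouched k S (revTripEnd k S x)) :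
    IsLeftBox k (revTripEnd k S x) (rightFaceBox S x) ∧
      ¬ IsLeftBox k (revTripEnd k S x) (leftFaceBox S x) := by
  have hr := hS.row_lt
  cases x with
  | bd => exact absurd rfl hx
  | wo r c =>
    have h0 : r < k := hv.elim (hr _ _) (·.2)
    by_cases h : (r, c) ∈ S
    · rcases c with _ | c <;>
        simp [h, revTripEnd, leftFaceBox, rightFaceBox, leftBox, IsLeftBox]
      omega
    · obtain ⟨rfl, -⟩ := hv.resolve_left h
      refine absurd ?_ h
      rcases hj with ⟨h1, h2⟩ | ⟨h1, h2⟩ <;> simp only [revTripEnd, h, if_false] at h1 h2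
      · rwa [show k - 1 - (k - 1 - r) = r by omega] at h2
      · omega
  | wi r c =>
    have h0 := hr _ _ hv
    rcases r with _ | r <;>
      simp [revTripEnd, leftFaceBox, rightFaceBox, upBox, IsLeftBox] <;> omega
  | wb r c =>
    have h0 := hr _ _ hv
    rcases r with _ | r <;> rcases c with _ | c <;>
      simp [revTripEnd, leftFaceBox, rightFaceBox, nwBox, IsLeftBox] <;> omega
  | bo r c =>
    by_cases h : (r, c) ∈ S
    · have h0 := hr _ _ h
      rcases r with _ | r <;>
        simp [h, revTripEnd, leftFaceBox, rightFaceBox, upBox, IsLeftBox] <;> omega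
    · obtain ⟨rfl, -⟩ := hv.resolve_left h
      refine absurd ?_ h
      rcases hj with ⟨h1, h2⟩ | ⟨h1, h2⟩ <;> simp only [revTripEnd, h, if_false] at h1 h2
      · omega
      · rwa [show k + c - k = c by omega] at h2
  | bi r c =>
    have h0 := hr _ _ hv
    rcases c with _ | c <;>
      simp [revTripEnd, leftFaceBox, rightFaceBox, leftBox, IsLeftBox] <;> omega
  | bb r c =>
    have h0 := hr _ _ hv
    rcases r with _ | r <;> rcases c with _ | c <;>
      simp [revTripEnd, leftFaceBox, rightFaceBox, nwBox, IsLeftBox] <;> omega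

/-- An edge is used only by the trips of its two darts, so crossing it leaves the position relative
to every other trip unchanged. -/
theorem isLeftBox_iff (hS : IsDiagramIn n k S) {x : BridgeDart} (hv : Valid n k S x)
    (hx : color x ≠ none) {j : ℕ} (h1 : j ≠ tripEnd k x)
    (h2 : j ≠ revTripEnd k S x) :
    IsLeftBox k j (leftFaceBox S x) ↔ IsLeftBox k j (rightFaceBox S x) := by
  have hr := hS.row_lt
  cases x with
  | bd => exact absurd rfl hx
  | wo r c =>
    have h0 : r < k := hv.elim (hr _ _) (·.2)
    by_cases h : (r, c) ∈ S
    · rcases c with _ | c <;>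
        simp [h, tripEnd, revTripEnd, leftFaceBox, rightFaceBox, leftBox, IsLeftBox] at * <;> omega
    · obtain ⟨rfl, -⟩ := hv.resolve_left h
      simp [h, leftFaceBox, rightFaceBox, leftBox]
  | wi r c =>
    have h0 := hr _ _ hv
    rcases r with _ | r <;>
      simp [tripEnd, revTripEnd, leftFaceBox, rightFaceBox, upBox, IsLeftBox] at * <;> omega
  | wb r c =>
    have h0 := hr _ _ hv
    rcases r with _ | r <;> rcases c with _ | c <;>
      simp [tripEnd, revTripEnd, leftFaceBox, rightFaceBox, nwBox, IsLeftBox] at * <;> omega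
  | bo r c =>
    by_cases h : (r, c) ∈ S
    · have h0 := hr _ _ h
      rcases r with _ | r <;>
        simp [h, tripEnd, revTripEnd, leftFaceBox, rightFaceBox, upBox, IsLeftBox] at * <;> omega
    · obtain ⟨rfl, -⟩ := hv.resolve_left h
      simp [h, leftFaceBox, rightFaceBox, upBox]
  | bi r c =>
    have h0 := hr _ _ hv
    rcases c with _ | c <;>
      simp [tripEnd, revTripEnd, leftFaceBox, rightFaceBox, leftBox, IsLeftBox] at * <;> omega
  | bb r c =>
    have h0 := hr _ _ hv
    rcases r with _ | r <;> rcases c with _ | c <;>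
      simp [tripEnd, revTripEnd, leftFaceBox, rightFaceBox, nwBox, IsLeftBox] at * <;> omega

/-- The rules of the road, checked at each kind of vertex: darts going in along a row stay in this
row until its first box, those going up a column stay in it until its first box, and the outward
darts `wo`, `bo` alternate along one diagonal staircase. -/
theorem tripEnd_turn (hS : IsDiagramIn n k S) {y z : BridgeDart} (hv : Valid n k S y)
    (hz : turn S y = some z) : color z ≠ none ∧ tripEnd k z = revTripEnd k S y := by
  have hk := hS.pos
  have hrow := hS.row_lt
  cases y with
  | bd i => simp [turn, color] at hz
  | wo r c =>
    simp only [turn, color, rtInv, Option.some.injEq] at hz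
    subst hz
    by_cases hrc : (r, c) ∈ S
    · simp [hrc, color, tripEnd, revTripEnd]
    · obtain ⟨rfl, -⟩ := hv.resolve_left hrc
      simp [hrc, color, tripEnd, revTripEnd]
  | wi r c =>
    simp only [turn, color, rtInv, Option.some.injEq] at hz
    subst hz
    simp [color, tripEnd, revTripEnd]
    omega
  | wb r c =>
    rcases c with _ | c <;>
      simp only [turn, color, rtInv, Option.some.injEq] at hz <;>
      subst hz <;> simp [color, tripEnd, revTripEnd]
  | bo r c =>
    simp only [turn, color, rt, Option.some.injEq] at hz
    subst hz
    by_cases hrc : (r, c) ∈ S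
    · simp [hrc, color, tripEnd, revTripEnd]
    · obtain ⟨rfl, -⟩ := hv.resolve_left hrc
      simp [hrc, color, tripEnd, revTripEnd]
      omega
  | bi r c =>
    simp only [turn, color, rt, Option.some.injEq] at hz
    subst hz
    have := hrow _ _ hv
    simp [color, tripEnd, revTripEnd]
    omega
  | bb r c =>
    rcases r with _ | r <;>
      simp only [turn, color, rt, Option.some.injEq] at hz <;>
      subst hz <;> simp [color, tripEnd, revTripEnd]
    omega

end BridgeDart

namespace DartNaming

open BridgeDart

variable {n k : ℕ} {G : PlabicMap n} {S : Set (ℕ × ℕ)}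

theorem map_tripNext (N : DartNaming G (Valid n k S) (rv k S) (rt S)) (d : G.Dart) :
    (G.tripNext d).map N.φ = turn S (N.φ (G.rev d)) := by
  by_cases h : color (N.φ (G.rev d)) = none
  · have : ∃ i, G.rev d = G.bd i := by
      by_contra! h'
      exact N.color_ne_none h' h
    obtain ⟨i, hi⟩ := this
    rw [PlabicMap.tripNext, (G.kind_eq_inl_iff _ i).2 hi, turn, h]
    rfl
  · obtain ⟨c, hc⟩ := Option.ne_none_iff_exists'.1 h
    rw [PlabicMap.tripNext, N.kind _ c hc, turn, hc]
    cases c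
    · exact congrArg some (N.rot_symm h)
    · exact congrArg some (N.rot _ h)

/-- The end of the trip of a dart. -/
noncomputable def tripTarget (N : DartNaming G (Valid n k S) (rv k S) (rt S)) (d : G.Dart) : ℕ :=
  match N.φ d with
  | .bd _ => revTripEnd k S (N.φ (G.rev d))
  | x => tripEnd k x

theorem tripTarget_of_color (N : DartNaming G (Valid n k S) (rv k S) (rt S)) {d : G.Dart}
    (hx : color (N.φ d) ≠ none) : N.tripTarget d = tripEnd k (N.φ d) := by
  rw [tripTarget]
  generalize N.φ d = x at *
  cases x <;> simp_all [color]

theorem tripTarget_bd (N : DartNaming G (Valid n k S) (rv k S) (rt S)) (i : Fin n) :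
    N.tripTarget (G.bd i) = revTripEnd k S (N.φ (G.rev (G.bd i))) := by
  rw [tripTarget, N.bd]

theorem color_rev_bd (N : DartNaming G (Valid n k S) (rv k S) (rt S)) (i : Fin n) :
    color (N.φ (G.rev (G.bd i))) ≠ none := by
  rcases N.rev_bd_cases i with ⟨r, c, h, -⟩ | ⟨r, c, h, -⟩ <;> simp [h, color]

theorem tripTarget_rev_bd (N : DartNaming G (Valid n k S) (rv k S) (rt S)) (i : Fin n) :
    N.tripTarget (G.rev (G.bd i)) = i := by
  rw [N.tripTarget_of_color (N.color_rev_bd i)]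
  rcases N.rev_bd_cases i with ⟨r, c, h, -, -, hi⟩ | ⟨r, c, h, -, -, hi⟩ <;> rw [h, hi] <;> rfl

theorem tripTarget_rev (hS : IsDiagramIn n k S)
    (N : DartNaming G (Valid n k S) (rv k S) (rt S)) {d : G.Dart}
    (hd : color (N.φ d) ≠ none) : N.tripTarget (G.rev d) = revTripEnd k S (N.φ d) := by
  have h3 := hS.lower
  have hr := N.rev d hd
  by_cases h : color (N.φ (G.rev d)) = none
  · have : ∃ i, G.rev d = G.bd i := by
      by_contra! h'
      exact N.color_ne_none h' h
    obtain ⟨i, hi⟩ := this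
    rw [hi, N.tripTarget_bd, ← hi, G.rev_rev]
  · rw [N.tripTarget_of_color h, hr]
    rw [hr] at h
    have hv := N.valid d
    cases hx : N.φ d with
    | wo r c =>
      rw [hx] at h
      have h' : (r + 1, c) ∈ S := by
        by_contra h'; simp [rv, h', color] at h
      simp [rv, tripEnd, revTripEnd, h', h3 _ _ _ _ h' (Nat.le_succ r) le_rfl]
    | bo r c =>
      rw [hx] at h
      have h' : (r, c + 1) ∈ S := by
        by_contra h'; simp [rv, h', color] at h
      simp [rv, tripEnd, revTripEnd, h', h3 _ _ _ _ h' le_rfl (Nat.le_succ c)]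
    | _ => rw [hx] at hd; simp_all [rv, tripEnd, revTripEnd, color]

theorem faceBox_rev (hS : IsDiagramIn n k S)
    (N : DartNaming G (Valid n k S) (rv k S) (rt S)) {d : G.Dart}
    (hd : color (N.φ d) ≠ none) : N.faceBox (G.rev d) = rightFaceBox S (N.φ d) := by
  have h3 := hS.lower
  have hr := N.rev d hd
  by_cases h : color (N.φ (G.rev d)) = none
  · have : ∃ i, G.rev d = G.bd i := by
      by_contra! h'
      exact N.color_ne_none h' h
    obtain ⟨i, hi⟩ := this
    rw [hi, N.faceBox_bd, ← hi, G.rev_rev]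
  · rw [N.faceBox_of_color rfl h, hr]
    rw [hr] at h
    have hv := N.valid d
    cases hx : N.φ d with
    | wo r c =>
      rw [hx] at h
      have h' : (r + 1, c) ∈ S := by
        by_contra h'; simp [rv, h', color] at h
      simp [rv, leftFaceBox, rightFaceBox, h', h3 _ _ _ _ h' (Nat.le_succ r) le_rfl]
    | bo r c =>
      rw [hx] at h
      have h' : (r, c + 1) ∈ S := by
        by_contra h'; simp [rv, h', color] at h
      simp [rv, leftFaceBox, rightFaceBox, h']
    | wi r c =>
      rw [hx] at hv
      simp [rv, leftFaceBox, rightFaceBox, h3 _ _ _ _ hv le_rfl (Nat.le_succ c)]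
    | _ => rw [hx] at hd; simp_all [rv, leftFaceBox, rightFaceBox, color]

theorem tripTarget_of_tripNext (hS : IsDiagramIn n k S)
    (N : DartNaming G (Valid n k S) (rv k S) (rt S)) {d e : G.Dart}
    (h : G.tripNext d = some e) : N.tripTarget e = N.tripTarget d := by
  have hm := N.map_tripNext d
  rw [h, Option.map_some] at hm
  set y := N.φ (G.rev d) with hy
  have hyc : color y ≠ none := by
    intro hc
    simp [turn, hc] at hm
  have hv : Valid n k S y := N.valid _
  have hd : N.tripTarget d = revTripEnd k S y := by
    rw [← G.rev_rev d, N.tripTarget_rev hS hyc]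
  obtain ⟨h1, h2⟩ := tripEnd_turn hS hv hm.symm
  rw [N.tripTarget_of_color h1, h2, hd]

theorem tripTarget_of_onTrip (hS : IsDiagramIn n k S)
    (N : DartNaming G (Valid n k S) (rv k S) (rt S)) {i : Fin n} {d : G.Dart}
    (h : G.OnTrip i d) : N.tripTarget d = N.tripTarget (G.bd i) := by
  induction h with
  | refl => rfl
  | tail _ h ih => rw [N.tripTarget_of_tripNext hS h, ih]

theorem exists_onTrip_of_turn (N : DartNaming G (Valid n k S) (rv k S) (rt S))
    {d e : G.Dart} (h : turn S (N.φ (G.rev d)) = some (N.φ e)) (hd : ∃ i, G.OnTrip i d) :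
    ∃ i, G.OnTrip i e := by
  obtain ⟨i, hi⟩ := hd
  refine ⟨i, hi.tail ?_⟩
  rw [← N.map_tripNext] at h
  obtain ⟨e', he', h⟩ := Option.map_eq_some_iff.1 h
  rw [he', N.inj h]

theorem exists_onTrip_of_next (N : DartNaming G (Valid n k S) (rv k S) (rt S))
    {d e : G.Dart} {x y : BridgeDart} (hd : N.φ d = x) (he : N.φ e = y) (hx : color x ≠ none)
    (h : turn S (rv k S x) = some y) (hdt : ∃ i, G.OnTrip i d) : ∃ i, G.OnTrip i e := by
  refine N.exists_onTrip_of_turn ?_ hdt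
  rw [N.rev d (by rwa [hd]), hd, he, h]

theorem exists_onTrip_of_bd (N : DartNaming G (Valid n k S) (rv k S) (rt S)) {e : G.Dart}
    {x y : BridgeDart} (hx : Valid n k S x) (hxc : color x ≠ none) {i : ℕ} (hi : i < n)
    (h : rv k S x = .bd i) (he : N.φ e = y) (hxy : turn S x = some y) :
    ∃ i, G.OnTrip i e := by
  refine N.exists_onTrip_of_turn (d := G.bd ⟨i, hi⟩) ?_ ⟨_, .refl⟩
  rw [N.rev_bd (i := ⟨i, hi⟩) hx hxc h, he, hxy]

/-- A bridge from white to black is reached by going up the column, so the trip is traced back down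
to the last box of the column, where it enters from the boundary. -/
theorem exists_onTrip_wb (hS : IsDiagramIn n k S)
    (N : DartNaming G (Valid n k S) (rv k S) (rt S)) (m : ℕ) {r c : ℕ} {d : G.Dart}
    (hm : r + m = k) (hd : N.φ d = .wb r c) : ∃ i, G.OnTrip i d := by
  have hrc : (r, c) ∈ S := by simpa [hd, Valid] using N.valid d
  induction m generalizing r d with
  | zero => have := hS.row_lt _ _ hrc; omega
  | succ m ih =>
    by_cases h : (r + 1, c) ∈ S
    · obtain ⟨e, he⟩ := N.exists_dart (x := .wb (r + 1) c) h
      obtain ⟨f, hf⟩ := N.exists_dart (x := .bi r c) h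
      exact N.exists_onTrip_of_next hf hd (by simp [color]) (by simp [rv, turn, color, rtInv, hrc])
        (N.exists_onTrip_of_next he hf (by simp [color]) (by simp [rv, turn, color, rt])
          (ih (by omega) he h))
    · have h1 := hS.col_lt _ _ hrc
      have h2 := hS.lt
      exact N.exists_onTrip_of_bd (x := .wo r c) (Or.inl hrc) (by simp [color])
        (i := k - 1 - r + c) (by omega) (by simp [rv, h]) hd (by simp [turn, color, rtInv, hrc])

/-- A bridge from black to white is reached by going left in the row, so the trip is traced back to
the last box of the row. -/
theorem exists_onTrip_bb (hS : IsDiagramIn n k S)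
    (N : DartNaming G (Valid n k S) (rv k S) (rt S)) (m : ℕ) {r c : ℕ} {d : G.Dart}
    (hm : c + m = n - k) (hd : N.φ d = .bb r c) : ∃ i, G.OnTrip i d := by
  have hrc : (r, c) ∈ S := by simpa [hd, Valid] using N.valid d
  have h0 := hS.col_lt _ _ hrc
  induction m generalizing c d with
  | zero => omega
  | succ m ih =>
    by_cases h : (r, c + 1) ∈ S
    · obtain ⟨e, he⟩ := N.exists_dart (x := .bb r (c + 1)) h
      obtain ⟨f, hf⟩ := N.exists_dart (x := .wi r c) h
      exact N.exists_onTrip_of_next hf hd (by simp [color]) (by simp [rv, turn, color, rt, hrc])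
        (N.exists_onTrip_of_next he hf (by simp [color]) (by simp [rv, turn, color, rtInv])
          (ih (by omega) he h (hS.col_lt _ _ h)))
    · have h1 := hS.row_lt _ _ hrc
      have h2 := hS.lt
      exact N.exists_onTrip_of_bd (x := .bo r c) (Or.inl hrc) (by simp [color])
        (i := k - 1 - r + c + 1) (by omega) (by simp [rv, h]) hd
        (by simp [turn, color, rt, hrc])

/-- Tracing a staircase back alternates `wo r (c + 1)`, `bo r c` and `bo (r + 1) c`, `wo r c`. The
sum of the indices drops until the first row or column, where the trip has just come up a column or
in along a row, or starts at a lollipop. -/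
theorem exists_onTrip_out (hS : IsDiagramIn n k S)
    (N : DartNaming G (Valid n k S) (rv k S) (rt S)) (m : ℕ) :
    (∀ r c d, r + c ≤ m → N.φ d = .wo r c → ∃ i, G.OnTrip i d) ∧
    (∀ r c d, r + c ≤ m → N.φ d = .bo r c → ∃ i, G.OnTrip i d) := by
  have h3 := hS.lower
  have h2 := hS.lt
  have h0 := hS.pos
  have hwo : ∀ r d, N.φ d = .wo r 0 → ∃ i, G.OnTrip i d := by
    intro r d hd
    by_cases h : (r, 0) ∈ S
    · obtain ⟨e, he⟩ := N.exists_dart (x := .bb r 0) h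
      exact N.exists_onTrip_of_next he hd (by simp [color]) (by simp [rv, turn, color, rtInv])
        (N.exists_onTrip_bb hS (n - k) (by simp) he)
    · have hv : r < k := by simpa [hd, Valid, h] using N.valid d
      have h' : (r + 1, 0) ∉ S := fun h' => h (h3 _ _ _ _ h' (by simp) (by simp))
      exact N.exists_onTrip_of_bd (x := .wo r 0) (Or.inr ⟨rfl, hv⟩) (by simp [color])
        (i := k - 1 - r) (by omega) (by simp [rv, h']) hd (by simp [turn, color, rtInv, h])
  have hbo : ∀ c d, N.φ d = .bo 0 c → ∃ i, G.OnTrip i d := by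
    intro c d hd
    by_cases h : (0, c) ∈ S
    · obtain ⟨e, he⟩ := N.exists_dart (x := .wb 0 c) h
      exact N.exists_onTrip_of_next he hd (by simp [color]) (by simp [rv, turn, color, rt])
        (N.exists_onTrip_wb hS k (by simp) he)
    · have hv : c < n - k := by simpa [hd, Valid, h] using N.valid d
      have h' : (0, c + 1) ∉ S := fun h' => h (h3 _ _ _ _ h' (by simp) (by simp))
      exact N.exists_onTrip_of_bd (x := .bo 0 c) (Or.inr ⟨rfl, hv⟩) (by simp [color])
        (i := k - 1 + c + 1) (by omega) (by simp [rv, h']) hd (by simp [turn, color, rt, h])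
  induction m with
  | zero =>
    constructor
    · intro r c d hrc hd
      obtain ⟨rfl, rfl⟩ : r = 0 ∧ c = 0 := by omega
      exact hwo _ _ hd
    · intro r c d hrc hd
      obtain ⟨rfl, rfl⟩ : r = 0 ∧ c = 0 := by omega
      exact hbo _ _ hd
  | succ m ih =>
    constructor
    · rintro r (_ | c) d hrc hd
      · exact hwo _ _ hd
      · have hv : (r, c + 1) ∈ S := by simpa [hd, Valid] using N.valid d
        obtain ⟨e, he⟩ := N.exists_dart (x := .bo r c) (Or.inl (h3 _ _ _ _ hv (by simp) (by simp)))
        exact N.exists_onTrip_of_next he hd (by simp [color])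
          (by simp [rv, turn, color, rtInv, hv]) (ih.2 _ _ _ (by omega) he)
    · rintro (_ | r) c d hrc hd
      · exact hbo _ _ hd
      · have hv : (r + 1, c) ∈ S := by simpa [hd, Valid] using N.valid d
        obtain ⟨e, he⟩ := N.exists_dart (x := .wo r c) (Or.inl (h3 _ _ _ _ hv (by simp) (by simp)))
        exact N.exists_onTrip_of_next he hd (by simp [color])
          (by simp [rv, turn, color, rt, hv]) (ih.1 _ _ _ (by omega) he)

theorem exists_onTrip (hS : IsDiagramIn n k S)
    (N : DartNaming G (Valid n k S) (rv k S) (rt S)) (d : G.Dart) : ∃ i, G.OnTrip i d := by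
  have hv := N.valid d
  cases hx : N.φ d with
  | bd i =>
    obtain ⟨hi, rfl⟩ := N.eq_bd hx
    exact ⟨_, .refl⟩
  | wo r c => exact (N.exists_onTrip_out hS (r + c)).1 r c d le_rfl hx
  | bo r c => exact (N.exists_onTrip_out hS (r + c)).2 r c d le_rfl hx
  | wb r c =>
    rw [hx] at hv
    exact N.exists_onTrip_wb hS (k - r) (by have := hS.row_lt _ _ hv; omega) hx
  | bb r c =>
    rw [hx] at hv
    exact N.exists_onTrip_bb hS (n - k - c) (by have := hS.col_lt _ _ hv; omega) hx
  | bi r c =>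
    rw [hx] at hv
    obtain ⟨e, he⟩ := N.exists_dart (x := .wb (r + 1) c) hv
    exact N.exists_onTrip_of_next he hx (by simp [color]) (by simp [rv, turn, color, rt])
      (N.exists_onTrip_wb hS (k - (r + 1)) (by have := hS.row_lt _ _ hv; omega) he)
  | wi r c =>
    rw [hx] at hv
    obtain ⟨e, he⟩ := N.exists_dart (x := .bb r (c + 1)) hv
    exact N.exists_onTrip_of_next he hx (by simp [color]) (by simp [rv, turn, color, rtInv])
      (N.exists_onTrip_bb hS (n - k - (c + 1)) (by have := hS.col_lt _ _ hv; omega) he)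

theorem tripTarget_bd_lt (hS : IsDiagramIn n k S)
    (N : DartNaming G (Valid n k S) (rv k S) (rt S)) (i : Fin n) : N.tripTarget (G.bd i) < n := by
  have h1 := hS.row_lt
  have h2 := hS.col_lt
  have h4 := hS.lt
  rw [N.tripTarget_bd]
  rcases N.rev_bd_cases i with ⟨r, c, h, hv, -⟩ | ⟨r, c, h, hv, -⟩ <;> rw [h, revTripEnd]
  · split_ifs with hrc
    · have := h2 _ _ hrc; omega
    · omega
  · split_ifs with hrc
    · omega
    · have := hv.resolve_left hrc; omega

theorem exists_tripTarget_bd (hS : IsDiagramIn n k S)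
    (N : DartNaming G (Valid n k S) (rv k S) (rt S)) (j : Fin n) :
    ∃ i, N.tripTarget (G.bd i) = j := by
  obtain ⟨i, hi⟩ := N.exists_onTrip hS (G.rev (G.bd j))
  exact ⟨i, by rw [← N.tripTarget_of_onTrip hS hi, N.tripTarget_rev_bd]⟩

/-- Since no dart lies on a closed trip, every `j` is the end of a trip that starts at the boundary;
a surjection of a finite set to itself is injective. -/
theorem tripTarget_bd_injective (hS : IsDiagramIn n k S)
    (N : DartNaming G (Valid n k S) (rv k S) (rt S)) {i j : Fin n}
    (h : N.tripTarget (G.bd i) = N.tripTarget (G.bd j)) : i = j := by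
  have : Function.Injective fun i => (⟨N.tripTarget (G.bd i), N.tripTarget_bd_lt hS i⟩ : Fin n) :=
    Finite.injective_iff_surjective.2 fun j => by
      obtain ⟨i, hi⟩ := N.exists_tripTarget_bd hS j
      exact ⟨i, Fin.ext hi⟩
  exact this (Fin.ext h)

/-- A dart is on some trip from the boundary, and different trips have different ends, so the
computed end identifies the trip. -/
theorem onTrip_iff (hS : IsDiagramIn n k S)
    (N : DartNaming G (Valid n k S) (rv k S) (rt S)) (i : Fin n) (d : G.Dart) :
    G.OnTrip i d ↔ N.tripTarget d = N.tripTarget (G.bd i) := by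
  refine ⟨N.tripTarget_of_onTrip hS, fun h => ?_⟩
  obtain ⟨j, hj⟩ := N.exists_onTrip hS d
  rwa [N.tripTarget_bd_injective hS (h.symm.trans (N.tripTarget_of_onTrip hS hj))]

theorem isTrip_iff (hS : IsDiagramIn n k S)
    (N : DartNaming G (Valid n k S) (rv k S) (rt S)) (i j : Fin n) :
    G.IsTrip i j ↔ N.tripTarget (G.bd i) = j := by
  rw [PlabicMap.IsTrip, N.onTrip_iff hS, N.tripTarget_rev_bd, eq_comm]

end DartNaming

/-! ### Target labels of the faces -/

theorem isLeftBox_iff_of_not_isTouched {n k : ℕ} {S : Set (ℕ × ℕ)} (hS : IsDiagramIn n k S)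
    {j : ℕ} (hj : ¬ IsTouched k S j) {X : Option (ℕ × ℕ)} (hX : ∀ b, X = some b → b ∈ S) :
    IsLeftBox k j X ↔ j < k := by
  have h3 := hS.lower
  rcases X with _ | ⟨s, t⟩
  · rfl
  · have hb := hX _ rfl
    have h0 := hS.row_lt _ _ hb
    -- If row `k - 1 - j` is empty, all boxes are above it; if column `j - k` is empty, all boxes
    -- are to its left.
    have h1 : j < k → s < k - 1 - j := fun h => by
      by_contra h'
      exact hj (Or.inl ⟨h, h3 _ _ _ _ hb (by omega) (by simp)⟩)
    have h2 : k ≤ j → t < j - k := fun h => by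
      by_contra h'
      exact hj (Or.inr ⟨h, h3 _ _ _ _ hb (by simp) (by omega)⟩)
    simp only [IsLeftBox]
    omega

theorem eq_of_isLeftBox_iff {n k : ℕ} {S : Set (ℕ × ℕ)} (hS : IsDiagramIn n k S)
    {X Y : Option (ℕ × ℕ)} (hX : ∀ b, X = some b → b ∈ S) (hY : ∀ b, Y = some b → b ∈ S)
    (h : ∀ j < n, IsLeftBox k j X ↔ IsLeftBox k j Y) : X = Y := by
  have h4 := hS.lt
  rcases X with _ | ⟨s, t⟩ <;> rcases Y with _ | ⟨s', t'⟩
  · rfl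
  · have h1 := hS.row_lt _ _ (hY _ rfl)
    have h2 := hS.col_lt _ _ (hY _ rfl)
    have := h (k + t') (by omega)
    simp only [IsLeftBox] at this
    omega
  · have h1 := hS.row_lt _ _ (hX _ rfl)
    have h2 := hS.col_lt _ _ (hX _ rfl)
    have := h (k + t) (by omega)
    simp only [IsLeftBox] at this
    omega
  · have h1 := hS.row_lt _ _ (hX _ rfl)
    have h2 := hS.col_lt _ _ (hX _ rfl)
    have h1' := hS.row_lt _ _ (hY _ rfl)
    have h2' := hS.col_lt _ _ (hY _ rfl)
    -- The columns are compared by `k + t`, the largest element of the label of `(s, t)`, and the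
    -- rows by `k - 1 - s`, the smallest number missing from it.
    have a1 := h (k + t) (by omega)
    have a2 := h (k + t') (by omega)
    have a3 := h (k - 1 - s) (by omega)
    have a4 := h (k - 1 - s') (by omega)
    simp only [IsLeftBox] at a1 a2 a3 a4
    have e1 : t = t' := by omega
    have e2 : s = s' := by omega
    rw [e1, e2]

theorem mem_rectDiagram {a b : ℕ} {x : ℕ × ℕ} : x ∈ rectDiagram a b ↔ x.1 < a ∧ x.2 < b := by
  change x ∈ Finset.range a ×ˢ Finset.range b ↔ _
  simp

theorem rowLen_rectDiagram (a b r : ℕ) : (rectDiagram a b).rowLen r = if r < a then b else 0 := by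
  refine eq_of_forall_lt_iff fun c => ?_
  rw [← YoungDiagram.mem_iff_lt_rowLen, mem_rectDiagram]
  split_ifs with h <;> simp [h]

theorem mem_verticalSteps_rect {n k : ℕ} {s t : ℕ} (hs : s < k) (j : Fin n) :
    j ∈ verticalSteps n k (rectDiagram (s + 1) (t + 1)) ↔ IsLeftBox k j (some (s, t)) := by
  have hj := j.2
  simp only [verticalSteps, Finset.mem_filter, Finset.mem_univ, true_and, rowLen_rectDiagram,
    Finset.mem_range, IsLeftBox]
  constructor
  · rintro ⟨r, hr, h⟩
    split_ifs at h <;> omega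
  · intro h
    -- Rows below the rectangle have length 0, so `j` is the step of row `k - 1 - j`; in the rows of
    -- the rectangle the step is shifted by `t + 1`, which gives row `k + t - j`.
    by_cases h' : s + (j : ℕ) + 1 < k
    · exact ⟨k - 1 - j, by omega, by rw [if_neg (by omega)]; omega⟩
    · exact ⟨k + t - j, by omega, by rw [if_pos (by omega)]; omega⟩

namespace DartNaming

open BridgeDart

variable {n k : ℕ} {G : PlabicMap n} {S : Set (ℕ × ℕ)}

theorem isLeftBox_faceBox (hS : IsDiagramIn n k S)
    (N : DartNaming G (Valid n k S) (rv k S) (rt S)) {d : G.Dart}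
    (hj : IsTouched k S (N.tripTarget d)) : IsLeftBox k (N.tripTarget d) (N.faceBox d) ∧
      ¬ IsLeftBox k (N.tripTarget d) (N.faceBox (G.rev d)) := by
  by_cases hd : color (N.φ d) = none
  · have : ∃ i, d = G.bd i := by
      by_contra! h
      exact N.color_ne_none h hd
    obtain ⟨i, rfl⟩ := this
    have hc := N.color_rev_bd i
    rw [N.tripTarget_bd] at hj ⊢
    rw [N.faceBox_bd, N.faceBox_of_color rfl hc]
    exact isLeftBox_rightFaceBox hS (N.valid _) hc hj
  · rw [N.tripTarget_of_color hd] at hj ⊢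
    rw [N.faceBox_rev hS hd, N.faceBox_of_color rfl hd]
    exact isLeftBox_leftFaceBox hS (N.valid _) hd hj

theorem isLeftBox_faceBox_iff (hS : IsDiagramIn n k S)
    (N : DartNaming G (Valid n k S) (rv k S) (rt S)) {d : G.Dart} {j : ℕ}
    (h1 : j ≠ N.tripTarget d) (h2 : j ≠ N.tripTarget (G.rev d)) :
    IsLeftBox k j (N.faceBox d) ↔ IsLeftBox k j (N.faceBox (G.rev d)) := by
  by_cases hd : color (N.φ d) = none
  · have : ∃ i, d = G.bd i := by
      by_contra! h
      exact N.color_ne_none h hd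
    obtain ⟨i, rfl⟩ := this
    have hc := N.color_rev_bd i
    rw [N.tripTarget_bd] at h1
    rw [N.tripTarget_of_color hc] at h2
    rw [N.faceBox_bd, N.faceBox_of_color rfl hc]
    exact (isLeftBox_iff hS (N.valid _) hc h2 h1).symm
  · rw [N.tripTarget_of_color hd] at h1
    rw [N.tripTarget_rev hS hd] at h2
    rw [N.faceBox_rev hS hd, N.faceBox_of_color rfl hd]
    exact isLeftBox_iff hS (N.valid _) hd h1 h2

theorem isLeftBox_of_isLeftOfTrip (hS : IsDiagramIn n k S)
    (N : DartNaming G (Valid n k S) (rv k S) (rt S)) {i : Fin n} {F : G.Face}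
    (hj : IsTouched k S (N.tripTarget (G.bd i))) (h : G.IsLeftOfTrip i F) :
    IsLeftBox k (N.tripTarget (G.bd i)) (N.boxOfFace hS F) := by
  obtain ⟨d, hd, h⟩ := h
  have hd' := (N.onTrip_iff hS i d).1 hd
  induction h with
  | refl => rw [N.boxOfFace_leftFace, ← hd']; exact (N.isLeftBox_faceBox hS (hd' ▸ hj)).1
  | tail _ h ih =>
    obtain ⟨e, he, he', rfl, rfl⟩ := h
    rw [N.onTrip_iff hS] at he he'
    exact (N.isLeftBox_faceBox_iff hS (Ne.symm he) (Ne.symm he')).1 ih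

/-- An edge of the trip would have a side on which `IsLeftBox` fails. So an edge with both sides on
the left is not on the trip and may be crossed. -/
theorem IsLeftOfTrip.cross (hS : IsDiagramIn n k S)
    (N : DartNaming G (Valid n k S) (rv k S) (rt S)) {i : Fin n} {e : G.Dart}
    (hj : IsTouched k S (N.tripTarget (G.bd i)))
    (h1 : IsLeftBox k (N.tripTarget (G.bd i)) (N.faceBox e))
    (h2 : IsLeftBox k (N.tripTarget (G.bd i)) (N.faceBox (G.rev e)))
    (h : G.IsLeftOfTrip i (G.leftFace e)) : G.IsLeftOfTrip i (G.leftFace (G.rev e)) := by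
  obtain ⟨d, hd, h⟩ := h
  refine ⟨d, hd, h.tail ⟨e, fun he => ?_, fun he => ?_, rfl, rfl⟩⟩
  · have he' := (N.onTrip_iff hS _ _).1 he
    rw [← he'] at h2 hj
    exact (N.isLeftBox_faceBox hS hj).2 h2
  · have he' := (N.onTrip_iff hS _ _).1 he
    rw [← he'] at h1 hj
    have := (N.isLeftBox_faceBox hS hj).2
    rw [G.rev_rev] at this
    exact this h1

/-- Being to the left of a trip passes from one side of a dart off the trip to the other side. -/
theorem isLeftOfTrip_of_dart (hS : IsDiagramIn n k S)
    (N : DartNaming G (Valid n k S) (rv k S) (rt S)) {i : Fin n} {x : BridgeDart}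
    {F F' : G.Face} (hx : Valid n k S x) (hc : color x ≠ none)
    (hj : IsTouched k S (N.tripTarget (G.bd i)))
    (hF : N.boxOfFace hS F = rightFaceBox S x) (hF' : N.boxOfFace hS F' = leftFaceBox S x)
    (h1 : IsLeftBox k (N.tripTarget (G.bd i)) (rightFaceBox S x))
    (h2 : IsLeftBox k (N.tripTarget (G.bd i)) (leftFaceBox S x))
    (h : G.IsLeftOfTrip i F) : G.IsLeftOfTrip i F' := by
  obtain ⟨d, rfl⟩ := N.exists_dart hx
  have e1 : F = G.leftFace (G.rev d) := N.boxOfFace_injective hS (by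
    rw [hF, N.boxOfFace_leftFace, N.faceBox_rev hS hc])
  have e2 : F' = G.leftFace d := N.boxOfFace_injective hS (by
    rw [hF', N.boxOfFace_leftFace, N.faceBox_of_color rfl hc])
  subst e1 e2
  rw [← N.faceBox_rev hS hc] at h1
  rw [← N.faceBox_of_color rfl hc] at h2
  have := IsLeftOfTrip.cross hS N hj h1 (by rwa [G.rev_rev]) h
  rwa [G.rev_rev] at this

/-- A chain of neighbouring faces, all of them on the left, leads from the given face to the trip:
northwest across bridges if the trip ends below `k`, and otherwise up, or northwest when going up
would leave the left side. The induction is on the row. -/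
theorem isLeftOfTrip_of_isLeftBox (hS : IsDiagramIn n k S)
    (N : DartNaming G (Valid n k S) (rv k S) (rt S)) {i : Fin n}
    (hj : IsTouched k S (N.tripTarget (G.bd i))) {F : G.Face}
    (hF : IsLeftBox k (N.tripTarget (G.bd i)) (N.boxOfFace hS F)) : G.IsLeftOfTrip i F := by
  have hnone : ∀ F : G.Face, N.boxOfFace hS F = none →
      N.tripTarget (G.bd i) < k → G.IsLeftOfTrip i F := by
    intro F hF hlt
    -- For an end `j < k` the trip turns around at the first white vertex of row `k - 1 - j`; the
    -- dart that leaves it has the outer face on its left.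
    obtain ⟨d, hd⟩ := N.exists_dart (x := .wo (k - 1 - N.tripTarget (G.bd i)) 0)
      (Or.inr ⟨rfl, by omega⟩)
    have hdt : N.tripTarget d = N.tripTarget (G.bd i) := by
      rw [N.tripTarget_of_color (by simp [hd, color]), hd, tripEnd]
      omega
    refine ⟨d, (N.onTrip_iff hS _ _).2 hdt, ?_⟩
    rw [show F = G.leftFace d from N.boxOfFace_injective hS (by
      rw [hF, N.boxOfFace_leftFace, N.faceBox_of_color hd (by simp [color])]; rfl)]
  have hsome : ∀ s t (F : G.Face), N.boxOfFace hS F = some (s, t) →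
      IsLeftBox k (N.tripTarget (G.bd i)) (some (s, t)) → G.IsLeftOfTrip i F := by
    intro s
    induction s with
    | zero =>
      intro t F hF h
      have hst := N.boxOfFace_mem hS hF
      by_cases hlt : N.tripTarget (G.bd i) < k
      · obtain ⟨F₀, hF₀⟩ := N.exists_boxOfFace_none hS
        refine N.isLeftOfTrip_of_dart hS (x := .wb 0 t) (F := F₀) hst (by simp [color]) hj
          (by rw [hF₀]; rfl) (by rw [hF]; rfl) hlt h (hnone F₀ hF₀ hlt)
      · have ht : N.tripTarget (G.bd i) = k + t := by
          simp only [IsLeftBox] at h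
          omega
        obtain ⟨d, hd⟩ := N.exists_dart (x := .wb 0 t) hst
        have hdt : N.tripTarget d = N.tripTarget (G.bd i) := by
          rw [N.tripTarget_of_color (by simp [hd, color]), hd, tripEnd, ht]
        refine ⟨d, (N.onTrip_iff hS _ _).2 hdt, ?_⟩
        rw [show F = G.leftFace d from N.boxOfFace_injective hS (by
          rw [hF, N.boxOfFace_leftFace, N.faceBox_of_color hd (by simp [color])]; rfl)]
    | succ s ih =>
      intro t F hF h
      have hst := N.boxOfFace_mem hS hF
      by_cases hlt : N.tripTarget (G.bd i) < k
      · rcases t with _ | t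
        · obtain ⟨F₀, hF₀⟩ := N.exists_boxOfFace_none hS
          exact N.isLeftOfTrip_of_dart hS (x := .wb (s + 1) 0) (F := F₀) hst (by simp [color]) hj
            (by rw [hF₀]; rfl) (by rw [hF]; rfl) hlt h (hnone F₀ hF₀ hlt)
        · obtain ⟨F₀, hF₀⟩ := N.exists_boxOfFace hS (b := (s, t))
            (hS.lower _ _ _ _ hst (by simp) (by simp))
          have h' : IsLeftBox k (N.tripTarget (G.bd i)) (some (s, t)) := by
            simp only [IsLeftBox] at h ⊢
            omega
          exact N.isLeftOfTrip_of_dart hS (x := .wb (s + 1) (t + 1)) (F := F₀) hst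
            (by simp [color]) hj (by rw [hF₀]; rfl) (by rw [hF]; rfl) h' h (ih t F₀ hF₀ h')
      -- Equality means that the box is on the edge of the left region along the staircase: the box
      -- above it is on the wrong side, but the northwest one is not.
      · by_cases hd : N.tripTarget (G.bd i) + (s + 1) = t + k
        · rcases t with _ | t
          · omega
          obtain ⟨F₀, hF₀⟩ := N.exists_boxOfFace hS (b := (s, t))
            (hS.lower _ _ _ _ hst (by simp) (by simp))
          have h' : IsLeftBox k (N.tripTarget (G.bd i)) (some (s, t)) := by
            simp only [IsLeftBox] at h ⊢
            omega
          exact N.isLeftOfTrip_of_dart hS (x := .wb (s + 1) (t + 1)) (F := F₀) hst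
            (by simp [color]) hj (by rw [hF₀]; rfl) (by rw [hF]; rfl) h' h (ih t F₀ hF₀ h')
        · obtain ⟨F₀, hF₀⟩ := N.exists_boxOfFace hS (b := (s, t))
            (hS.lower _ _ _ _ hst (by simp) (by simp))
          have h' : IsLeftBox k (N.tripTarget (G.bd i)) (some (s, t)) := by
            simp only [IsLeftBox] at h ⊢
            omega
          exact N.isLeftOfTrip_of_dart hS (x := .bo (s + 1) t) (F := F₀) (Or.inl hst)
            (by simp [color]) hj (by rw [hF₀]; rfl) (by rw [hF]; simp [leftFaceBox, hst]) h'
            (by simpa [leftFaceBox, hst] using h) (ih t F₀ hF₀ h')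
  rcases hb : N.boxOfFace hS F with _ | ⟨s, t⟩
  · rw [hb] at hF
    exact hnone F hb hF
  · rw [hb] at hF
    exact hsome s t F hb hF

/-- This separates the two clauses in the definition of the target label: a trip from `j` to itself
occurs exactly at the lollipops, and a lollipop is white exactly when `j < k`. -/
theorem isTouched_cases (hS : IsDiagramIn n k S)
    (N : DartNaming G (Valid n k S) (rv k S) (rt S)) (j : Fin n) :
    (IsTouched k S j ∧ ¬ G.IsLollipop j ∧ N.tripTarget (G.bd j) ≠ j) ∨
    (¬ IsTouched k S j ∧ G.IsLollipop j ∧ N.tripTarget (G.bd j) = j ∧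
      (G.kind (G.rev (G.bd j)) = Sum.inr .white ↔ (j : ℕ) < k)) := by
  have h3 := hS.lower
  have hk := hS.pos
  have hl : G.IsLollipop j ↔ rt S (N.φ (G.rev (G.bd j))) = N.φ (G.rev (G.bd j)) := by
    rw [PlabicMap.IsLollipop, ← N.rot _ (N.color_rev_bd j), N.inj.eq_iff]
  have hkind := N.kind (G.rev (G.bd j))
  rw [hl, N.tripTarget_bd]
  rcases N.rev_bd_cases j with ⟨r, c, h, hv, hn, hj⟩ | ⟨r, c, h, hv, hn, hj⟩ <;>
    rw [h] at hkind ⊢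
  · by_cases hrc : (r, c) ∈ S
    · have h0 := hS.row_lt _ _ hrc
      refine Or.inl ⟨?_, by cases c <;> simp [rt, hrc], by simp [revTripEnd, hrc]; omega⟩
      by_cases hjk : (j : ℕ) < k
      · exact Or.inl ⟨hjk, h3 _ _ _ _ hrc (by omega) (by simp)⟩
      · exact Or.inr ⟨by omega, h3 _ _ _ _ hrc (by simp) (by omega)⟩
    · obtain ⟨rfl, h0⟩ := hv.resolve_left hrc
      refine Or.inr ⟨?_, by simp [rt, hrc], by simp [revTripEnd, hrc, hj], ?_⟩
      · rintro (⟨-, h'⟩ | ⟨h', -⟩)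
        · rw [show k - 1 - (j : ℕ) = r by omega] at h'
          exact hrc h'
        · omega
      · rw [hkind .white rfl]
        simp
        omega
  · by_cases hrc : (r, c) ∈ S
    · have h0 := hS.row_lt _ _ hrc
      refine Or.inl ⟨?_, by simp [rt, hrc], by simp [revTripEnd, hrc]; omega⟩
      by_cases hjk : (j : ℕ) < k
      · exact Or.inl ⟨hjk, h3 _ _ _ _ hrc (by omega) (by simp)⟩
      · exact Or.inr ⟨by omega, h3 _ _ _ _ hrc (by simp) (by omega)⟩
    · obtain ⟨rfl, h0⟩ := hv.resolve_left hrc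
      refine Or.inr ⟨?_, by simp [rt, hrc], by simp [revTripEnd, hrc, hj]; omega, ?_⟩
      · rintro (⟨h', -⟩ | ⟨-, h'⟩)
        · omega
        · rw [show (j : ℕ) - k = c by omega] at h'
          exact hrc h'
      · rw [hkind .black rfl]
        simp
        omega

theorem mem_targetLabel_iff (hS : IsDiagramIn n k S)
    (N : DartNaming G (Valid n k S) (rv k S) (rt S)) (F : G.Face) (j : Fin n) :
    j ∈ G.targetLabel F ↔ IsLeftBox k j (N.boxOfFace hS F) := by
  simp only [PlabicMap.targetLabel, Set.mem_ofPred_eq, N.isTrip_iff hS]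
  rcases N.isTouched_cases hS j with ⟨h1, h2, h3⟩ | ⟨h1, h2, h3, h4⟩
  · constructor
    · rintro (⟨i, -, hi, h⟩ | h)
      · rw [← hi] at h1 ⊢
        exact N.isLeftBox_of_isLeftOfTrip hS h1 h
      · exact absurd h.1 h3
    · intro h
      obtain ⟨i, hi⟩ := N.exists_tripTarget_bd hS j
      refine Or.inl ⟨i, ?_, hi, ?_⟩
      · rintro rfl
        exact h3 hi
      · rw [← hi] at h1 h
        exact N.isLeftOfTrip_of_isLeftBox hS h1 h
  · rw [isLeftBox_iff_of_not_isTouched hS h1 fun b hb => N.boxOfFace_mem hS hb, h4]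
    constructor
    · rintro (⟨i, hij, hi, -⟩ | h)
      · exact absurd (N.tripTarget_bd_injective hS (hi.trans h3.symm)) hij
      · exact h.2.2
    · exact fun h => Or.inr ⟨h3, h2, h⟩

theorem targetLabel_injective (hS : IsDiagramIn n k S)
    (N : DartNaming G (Valid n k S) (rv k S) (rt S)) : Function.Injective G.targetLabel := by
  intro F F' h
  refine N.boxOfFace_injective hS (eq_of_isLeftBox_iff hS (fun b hb => N.boxOfFace_mem hS hb)
    (fun b hb => N.boxOfFace_mem hS hb) fun j hj => ?_)
  rw [← N.mem_targetLabel_iff hS F ⟨j, hj⟩, ← N.mem_targetLabel_iff hS F' ⟨j, hj⟩, h]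

theorem targetLabel_of_some (hS : IsDiagramIn n k S)
    (N : DartNaming G (Valid n k S) (rv k S) (rt S)) {F : G.Face} {b : ℕ × ℕ}
    (h : N.boxOfFace hS F = some b) : G.targetLabel F = ↑(verticalSteps n k (rectOfBox b)) := by
  have hb := N.boxOfFace_mem hS h
  ext j
  rw [N.mem_targetLabel_iff hS, h, Finset.mem_coe, rectOfBox,
    mem_verticalSteps_rect (hS.row_lt _ _ hb)]

theorem targetLabel_of_none (hS : IsDiagramIn n k S)
    (N : DartNaming G (Valid n k S) (rv k S) (rt S)) {F : G.Face}
    (h : N.boxOfFace hS F = none) : G.targetLabel F = ↑(initialSubset n k) := by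
  ext j
  rw [N.mem_targetLabel_iff hS, h, Finset.mem_coe]
  simp [initialSubset, IsLeftBox]

theorem targetLabel_eq_rect_iff (hS : IsDiagramIn n k S)
    (N : DartNaming G (Valid n k S) (rv k S) (rt S)) {F : G.Face} {b : ℕ × ℕ} (hb : b ∈ S) :
    G.targetLabel F = ↑(verticalSteps n k (rectOfBox b)) ↔ N.boxOfFace hS F = some b := by
  obtain ⟨F', hF'⟩ := N.exists_boxOfFace hS hb
  rw [← N.targetLabel_of_some hS hF', (N.targetLabel_injective hS).eq_iff, ← hF',
    (N.boxOfFace_injective hS).eq_iff]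

theorem targetLabel_eq_initial_iff (hS : IsDiagramIn n k S)
    (N : DartNaming G (Valid n k S) (rv k S) (rt S)) {F : G.Face} :
    G.targetLabel F = ↑(initialSubset n k) ↔ N.boxOfFace hS F = none := by
  obtain ⟨F', hF'⟩ := N.exists_boxOfFace_none hS
  rw [← N.targetLabel_of_none hS hF', (N.targetLabel_injective hS).eq_iff, ← hF',
    (N.boxOfFace_injective hS).eq_iff]

end DartNaming

/-! ### Counting edges: the arrows of the dual quiver -/

open Classical in
/-- The number of edges from the face of the box `X` to the face of the box `Y`. -/
noncomputable def boxCrossings (S : Set (ℕ × ℕ)) (X Y : Option (ℕ × ℕ)) : ℕ :=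
  (if ∃ r c, (r, c) ∈ S ∧ X = nwBox r c ∧ Y = some (r, c) then 1 else 0) +
  (if ∃ r c, (r + 1, c) ∈ S ∧ X = some (r, c) ∧ Y = leftBox r c then 1 else 0) +
  (if ∃ r c, (r, c + 1) ∈ S ∧ X = some (r, c) ∧ Y = upBox r c then 1 else 0)

/-- There is an arrow from the box `a` to the box `b` in the quiver on the boxes of a diagram in
which they are not both frozen. -/
def IsArrow (a b : ℕ × ℕ) : Prop :=
  a = (b.1 + 1, b.2) ∨ a = (b.1, b.2 + 1) ∨ b = (a.1 + 1, a.2 + 1)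

section boxCrossings

variable {n k : ℕ} {S : Set (ℕ × ℕ)}

/-- If one of two neighbouring boxes has a southeast neighbour, then the box whose vertex lies on
the separating edge is in `S`, too. The three kinds of edges give different displacements, so only
one of them contributes. -/
theorem boxCrossings_eq_one (hS : IsDiagramIn n k S) {a b : ℕ × ℕ} (hb : b ∈ S)
    (hab : (a.1 + 1, a.2 + 1) ∈ S ∨ (b.1 + 1, b.2 + 1) ∈ S) (h : IsArrow a b) :
    boxCrossings S (some a) (some b) = 1 := by
  have h3 := hS.lower
  obtain ⟨r, c⟩ := b
  rcases h with rfl | rfl | h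
  · rw [boxCrossings, if_neg, if_neg, if_pos]
    · exact ⟨r + 1, c, by rcases hab with h | h <;> exact h3 _ _ _ _ h (by simp) (by simp), rfl, rfl⟩
    · rintro ⟨r', _ | c', -, h1, h2⟩ <;> simp [leftBox] at h1 h2
      omega
    · rintro ⟨_ | r', _ | c', -, h1, h2⟩ <;> simp [nwBox] at h1 h2
      omega
  · rw [boxCrossings, if_neg, if_pos, if_neg]
    · rintro ⟨_ | r', c', -, h1, h2⟩ <;> simp [upBox] at h1 h2
      omega
    · exact ⟨r, c + 1, by rcases hab with h | h <;> exact h3 _ _ _ _ h (by simp) (by simp), rfl, rfl⟩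
    · rintro ⟨_ | r', _ | c', -, h1, h2⟩ <;> simp [nwBox] at h1 h2
      omega
  · obtain ⟨r', c'⟩ := a
    obtain ⟨rfl, rfl⟩ := Prod.mk.inj h
    rw [boxCrossings, if_pos, if_neg, if_neg]
    · rintro ⟨_ | r', c', -, h1, h2⟩ <;> simp [upBox] at h1 h2
      omega
    · rintro ⟨r', _ | c', -, h1, h2⟩ <;> simp [leftBox] at h1 h2
      omega
    · exact ⟨_, _, hb, rfl, rfl⟩

theorem boxCrossings_eq_zero {a b : ℕ × ℕ} (h : ¬ IsArrow a b) :
    boxCrossings S (some a) (some b) = 0 := by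
  rw [boxCrossings, if_neg, if_neg, if_neg]
  · rintro ⟨_ | r, c, -, h1, h2⟩ <;> simp only [upBox, Option.some.injEq, reduceCtorEq] at h1 h2
    subst h1 h2
    exact h (Or.inl rfl)
  · rintro ⟨r, _ | c, -, h1, h2⟩ <;> simp only [leftBox, Option.some.injEq, reduceCtorEq] at h1 h2
    subst h1 h2
    exact h (Or.inr (Or.inl rfl))
  · rintro ⟨_ | r, _ | c, -, h1, h2⟩ <;>
      simp only [nwBox, Option.some.injEq, reduceCtorEq] at h1 h2
    subst h1 h2
    exact h (Or.inr (Or.inr rfl))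

/-- So no oriented 2-cycles occur between faces of boxes; the cancellation matters only at the outer
face. -/
theorem IsArrow.not_symm {a b : ℕ × ℕ} (h : IsArrow a b) : ¬ IsArrow b a := by
  obtain ⟨r, c⟩ := a
  obtain ⟨r', c'⟩ := b
  simp only [IsArrow, Prod.mk.injEq] at *
  omega

-- A box in the first column has an edge to the outer face in place of its left neighbour, one in
-- the first row in place of the box above; the box `(0, 0)` has both.
open Classical in
theorem boxCrossings_some_none (hS : IsDiagramIn n k S) {a : ℕ × ℕ}
    (ha : (a.1 + 1, a.2 + 1) ∈ S) : boxCrossings S (some a) none =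
      (if a.2 = 0 then 1 else 0) + (if a.1 = 0 then 1 else 0) := by
  have h3 := hS.lower
  obtain ⟨r, c⟩ := a
  rw [boxCrossings, if_neg (by simp), Nat.zero_add]
  congr 1
  · refine if_congr ⟨?_, ?_⟩ rfl rfl
    · rintro ⟨r', _ | c', -, h1, h2⟩ <;> simp_all [leftBox]
    · rintro rfl
      exact ⟨r, 0, h3 _ _ _ _ ha le_rfl (by simp), rfl, rfl⟩
  · refine if_congr ⟨?_, ?_⟩ rfl rfl
    · rintro ⟨_ | r', c', -, h1, h2⟩ <;> simp_all [upBox]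
    · rintro rfl
      exact ⟨0, c, h3 _ _ _ _ ha (by simp) le_rfl, rfl, rfl⟩

-- Only the bridge of the box contributes, since it has the outer face behind it when there is no
-- northwest neighbour. At `(0, 0)` this is still a single edge.
open Classical in
theorem boxCrossings_none_some {a : ℕ × ℕ} (ha : a ∈ S) : boxCrossings S none (some a) =
    if a.1 = 0 ∨ a.2 = 0 then 1 else 0 := by
  obtain ⟨r, c⟩ := a
  rw [boxCrossings, if_neg (by simp : ¬ ∃ r' c', (r' + 1, c') ∈ S ∧ none = some (r', c') ∧ _),
    if_neg (by simp : ¬ ∃ r' c', (r', c' + 1) ∈ S ∧ none = some (r', c') ∧ _)]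
  refine if_congr ⟨?_, ?_⟩ rfl rfl
  · rintro ⟨_ | r', _ | c', -, h1, h2⟩ <;> simp_all [nwBox]
  · rintro (rfl | rfl)
    · exact ⟨0, c, ha, rfl, rfl⟩
    · exact ⟨r, 0, ha, by cases r <;> rfl, rfl⟩

end boxCrossings

namespace DartNaming

open BridgeDart

variable {n k : ℕ} {G : PlabicMap n} {S : Set (ℕ × ℕ)}

theorem kind_eq_inr_iff (N : DartNaming G (Valid n k S) (rv k S) (rt S)) {d : G.Dart}
    {c : PlabicColor} : G.kind d = Sum.inr c ↔ color (N.φ d) = some c := by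
  refine ⟨fun h => ?_, N.kind d c⟩
  have hc : color (N.φ d) ≠ none := N.color_ne_none fun i hi => by
    rw [(G.kind_eq_inl_iff d i).2 hi] at h
    simp at h
  obtain ⟨c', hc'⟩ := Option.ne_none_iff_exists'.1 hc
  have := N.kind d c' hc'
  rw [hc', Sum.inr_injective (this.symm.trans h)]

open Classical in
theorem ncard_eq (N : DartNaming G (Valid n k S) (rv k S) (rt S)) {p : BridgeDart → Prop}
    (hv : ∀ x, p x → Valid n k S x) (hp : ∀ x y, p x → p y → x = y) :
    {d | p (N.φ d)}.ncard = if ∃ x, p x then 1 else 0 := by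
  split_ifs with h
  · obtain ⟨x, hx⟩ := h
    obtain ⟨d, rfl⟩ := N.exists_dart (hv x hx)
    rw [Set.ncard_eq_one]
    refine ⟨d, Set.eq_singleton_iff_unique_mem.2 ⟨hx, fun e he => N.inj (hp _ _ he hx)⟩⟩
  · rw [Set.ncard_eq_zero (Set.toFinite _)]
    ext d
    simpa using fun hd => h ⟨_, hd⟩

-- The edges between internal vertices are sorted by the name of their white dart: `wb`, `wo` or
-- `wi`. In each class one of the two faces has the box in the name of the dart, so a pair of faces
-- is separated by at most one edge of this class.
open Classical in
theorem crossings_eq (hS : IsDiagramIn n k S)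
    (N : DartNaming G (Valid n k S) (rv k S) (rt S)) (F F' : G.Face) :
    G.crossings F F' = boxCrossings S (N.boxOfFace hS F) (N.boxOfFace hS F') := by
  set X := N.boxOfFace hS F with hX
  set Y := N.boxOfFace hS F' with hY
  let p₁ : BridgeDart → Prop := fun x =>
    ∃ r c, x = .wb r c ∧ (r, c) ∈ S ∧ X = nwBox r c ∧ Y = some (r, c)
  let p₂ : BridgeDart → Prop := fun x =>
    ∃ r c, x = .wo r c ∧ (r + 1, c) ∈ S ∧ X = some (r, c) ∧ Y = leftBox r c
  let p₃ : BridgeDart → Prop := fun x =>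
    ∃ r c, x = .wi r c ∧ (r, c + 1) ∈ S ∧ X = some (r, c) ∧ Y = upBox r c
  have hset : {d : G.Dart | G.kind d = Sum.inr .white ∧ G.kind (G.rev d) = Sum.inr .black ∧
      G.rightFace d = F ∧ G.leftFace d = F'} =
      ({d | p₁ (N.φ d)} ∪ {d | p₂ (N.φ d)}) ∪ {d | p₃ (N.φ d)} := by
    ext d
    simp only [Set.mem_ofPred_eq, Set.mem_union, N.kind_eq_inr_iff, p₁, p₂, p₃]
    by_cases hd : color (N.φ d) = some .white
    · have hd' : color (N.φ d) ≠ none := by simp [hd]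
      have e1 : G.rightFace d = F ↔ X = rightFaceBox S (N.φ d) := by
        rw [hX, ← N.faceBox_rev hS hd', ← N.boxOfFace_leftFace hS,
          (N.boxOfFace_injective hS).eq_iff, eq_comm]
        exact Iff.rfl
      have e2 : G.leftFace d = F' ↔ Y = leftFaceBox S (N.φ d) := by
        rw [hY, ← N.faceBox_of_color rfl hd', ← N.boxOfFace_leftFace hS,
          (N.boxOfFace_injective hS).eq_iff, eq_comm]
      rw [e1, e2, N.rev d hd']
      have hv := N.valid d
      have h3 := hS.lower
      cases hx : N.φ d with
      | wo r c =>
        by_cases h : (r + 1, c) ∈ S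
        · have h' : (r, c) ∈ S := h3 _ _ _ _ h (Nat.le_succ r) le_rfl
          simp [rv, h, h', color, leftFaceBox, rightFaceBox]
        · simp [rv, h, color]
      | wi r c =>
        have h : (r, c + 1) ∈ S := by simpa [hx, Valid] using hv
        simp [rv, h, color, leftFaceBox, rightFaceBox]
      | wb r c =>
        have h : (r, c) ∈ S := by simpa [hx, Valid] using hv
        simp [rv, h, color, leftFaceBox, rightFaceBox]
      | _ => rw [hx] at hd; simp [color] at hd
    · simp only [hd, false_and, false_iff]
      rintro ((⟨r, c, h, -⟩ | ⟨r, c, h, -⟩) | ⟨r, c, h, -⟩) <;> simp [h, color] at hd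
  have h₁₂ : Disjoint {d | p₁ (N.φ d)} {d | p₂ (N.φ d)} := by
    rw [Set.disjoint_left]
    rintro d ⟨r, c, h, -⟩ ⟨r', c', h', -⟩
    simp [h] at h'
  have h₁₂₃ : Disjoint ({d | p₁ (N.φ d)} ∪ {d | p₂ (N.φ d)}) {d | p₃ (N.φ d)} := by
    rw [Set.disjoint_left]
    rintro d (⟨r, c, h, -⟩ | ⟨r, c, h, -⟩) ⟨r', c', h', -⟩ <;> simp [h] at h'
  rw [PlabicMap.crossings, hset, Set.ncard_union_eq h₁₂₃ (Set.toFinite _) (Set.toFinite _),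
    Set.ncard_union_eq h₁₂ (Set.toFinite _) (Set.toFinite _), N.ncard_eq, N.ncard_eq,
    N.ncard_eq, boxCrossings]
  · congr 1
    · congr 1
      · exact if_congr ⟨fun ⟨_, r, c, _, h⟩ => ⟨r, c, h⟩, fun ⟨r, c, h⟩ => ⟨_, r, c, rfl, h⟩⟩ rfl rfl
      · exact if_congr ⟨fun ⟨_, r, c, _, h⟩ => ⟨r, c, h⟩, fun ⟨r, c, h⟩ => ⟨_, r, c, rfl, h⟩⟩ rfl rfl
    · exact if_congr ⟨fun ⟨_, r, c, _, h⟩ => ⟨r, c, h⟩, fun ⟨r, c, h⟩ => ⟨_, r, c, rfl, h⟩⟩ rfl rfl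
  · rintro _ ⟨r, c, rfl, h, -⟩
    exact h
  · rintro _ _ ⟨r, c, rfl, -, h, -⟩ ⟨r', c', rfl, -, h', -⟩
    simpa using h.symm.trans h'
  · rintro _ ⟨r, c, rfl, h, -⟩
    exact Or.inl (hS.lower _ _ _ _ h (by simp) le_rfl)
  · rintro _ _ ⟨r, c, rfl, -, h, -⟩ ⟨r', c', rfl, -, h', -⟩
    simpa using h.symm.trans h'
  · rintro _ ⟨r, c, rfl, h, -⟩
    exact h
  · rintro _ _ ⟨r, c, rfl, -, -, h⟩ ⟨r', c', rfl, -, -, h'⟩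
    simpa using h.symm.trans h'

open Classical in
theorem arrows_some_some (hS : IsDiagramIn n k S)
    (N : DartNaming G (Valid n k S) (rv k S) (rt S)) {F F' : G.Face} {a b : ℕ × ℕ}
    (ha : N.boxOfFace hS F = some a) (hb : N.boxOfFace hS F' = some b) :
    G.dualQuiver.arrows F F' =
      if IsArrow a b ∧ ¬ (G.IsBoundaryFace F ∧ G.IsBoundaryFace F') then 1 else 0 := by
  have ha' := N.boxOfFace_mem hS ha
  have hb' := N.boxOfFace_mem hS hb
  have h1 : G.IsBoundaryFace F ↔ (a.1 + 1, a.2 + 1) ∉ S := by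
    rw [N.isBoundaryFace_iff hS, ha]
    exact ⟨fun h => h _ _ rfl, by rintro h _ _ ⟨⟩; exact h⟩
  have h2 : G.IsBoundaryFace F' ↔ (b.1 + 1, b.2 + 1) ∉ S := by
    rw [N.isBoundaryFace_iff hS, hb]
    exact ⟨fun h => h _ _ rfl, by rintro h _ _ ⟨⟩; exact h⟩
  simp only [PlabicMap.dualQuiver, N.crossings_eq hS, ha, hb]
  by_cases hfr : G.IsBoundaryFace F ∧ G.IsBoundaryFace F'
  · simp [hfr]
  · have hor : (a.1 + 1, a.2 + 1) ∈ S ∨ (b.1 + 1, b.2 + 1) ∈ S := by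
      rw [h1, h2] at hfr
      tauto
    rw [if_neg hfr]
    by_cases h : IsArrow a b
    · rw [boxCrossings_eq_one hS hb' hor h, boxCrossings_eq_zero h.not_symm, if_pos ⟨h, hfr⟩]
    · rw [boxCrossings_eq_zero h, if_neg fun h' => h h'.1, Nat.zero_sub]

open Classical in
theorem arrows_some_none (hS : IsDiagramIn n k S)
    (N : DartNaming G (Valid n k S) (rv k S) (rt S)) {F F₀ : G.Face} {a : ℕ × ℕ}
    (ha : N.boxOfFace hS F = some a) (h0 : N.boxOfFace hS F₀ = none) :
    G.dualQuiver.arrows F F₀ =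
      (if a = (0, 0) ∧ ¬ (G.IsBoundaryFace F ∧ G.IsBoundaryFace F₀) then 1 else 0) ∧
    G.dualQuiver.arrows F₀ F = 0 := by
  have ha' := N.boxOfFace_mem hS ha
  have h1 : G.IsBoundaryFace F ↔ (a.1 + 1, a.2 + 1) ∉ S := by
    rw [N.isBoundaryFace_iff hS, ha]
    exact ⟨fun h => h _ _ rfl, by rintro h _ _ ⟨⟩; exact h⟩
  have h2 : G.IsBoundaryFace F₀ := by
    rw [N.isBoundaryFace_iff hS, h0]
    simp
  simp only [PlabicMap.dualQuiver, N.crossings_eq hS, ha, h0, h2, and_true, true_and]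
  by_cases hfr : G.IsBoundaryFace F
  · simp [hfr]
  · have hfr' : (a.1 + 1, a.2 + 1) ∈ S := not_not.1 (mt h1.2 hfr)
    simp only [hfr, if_false, not_false_eq_true, and_true]
    rw [boxCrossings_some_none hS hfr', boxCrossings_none_some ha']
    -- At `(0, 0)` the count is 2 against 1, elsewhere in the first row or column 1 against 1, and
    -- otherwise 0 against 0; the truncated difference is the cancellation of 2-cycles.
    obtain ⟨_ | r, _ | c⟩ := a <;> simp

end DartNaming

/-! ### From boxes to rectangles, and the theorem -/

theorem isNonemptyRect_iff {μ : YoungDiagram} : IsNonemptyRect μ ↔ ∃ b, μ = rectOfBox b := by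
  constructor
  · rintro ⟨_ | r, _ | c, hr, hc, rfl⟩
    · omega
    · omega
    · omega
    · exact ⟨(r, c), rfl⟩
  · rintro ⟨b, rfl⟩
    exact ⟨b.1 + 1, b.2 + 1, by omega, by omega, rfl⟩

theorem rectOfBox_le_iff {b : ℕ × ℕ} {lam : YoungDiagram} : rectOfBox b ≤ lam ↔ b ∈ lam := by
  constructor
  · intro h
    exact h (mem_rectDiagram.2 ⟨Nat.lt_succ_self _, Nat.lt_succ_self _⟩)
  · intro h x hx
    have hx' := mem_rectDiagram.1 hx
    exact lam.isLowerSet (show x ≤ b from ⟨Nat.le_of_lt_succ hx'.1, Nat.le_of_lt_succ hx'.2⟩) h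

theorem rectOfBox_injective : Function.Injective rectOfBox := by
  intro a b h
  have h1 := rectOfBox_le_iff.1 h.le
  have h2 := rectOfBox_le_iff.1 h.ge
  have h1' := mem_rectDiagram.1 h1
  have h2' := mem_rectDiagram.1 h2
  ext <;> omega

theorem rectDiagram_eq_rectOfBox_iff {r c : ℕ} {b : ℕ × ℕ} (hr : 0 < r) (hc : 0 < c) :
    rectOfBox b = rectDiagram r c ↔ r = b.1 + 1 ∧ c = b.2 + 1 := by
  obtain ⟨r, rfl⟩ := Nat.exists_eq_succ_of_ne_zero hr.ne'
  obtain ⟨c, rfl⟩ := Nat.exists_eq_succ_of_ne_zero hc.ne'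
  constructor
  · intro h
    have h' : rectOfBox b = rectOfBox (r, c) := h
    rw [rectOfBox_injective h']
    exact ⟨rfl, rfl⟩
  · rintro ⟨h1, h2⟩
    rw [h1, h2]
    rfl

/-- In terms of the lower right corner, removing a row is a step up, removing a column a step to the
left, and adding a hook a diagonal step to the southeast. -/
theorem isArrow_iff {a b : ℕ × ℕ} : (RemovesRowOrColumn (rectOfBox a) (rectOfBox b) ∨
    AddsHook (rectOfBox a) (rectOfBox b)) ↔ IsArrow a b := by
  obtain ⟨r, c⟩ := a
  obtain ⟨r', c'⟩ := b
  constructor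
  · rintro (⟨s, t, hs, ht, h1, h2⟩ | ⟨s, t, hs, ht, h1, h2⟩)
    · rw [rectDiagram_eq_rectOfBox_iff hs ht] at h1
      rw [rectDiagram_eq_rectOfBox_iff (Nat.succ_pos s) ht,
        rectDiagram_eq_rectOfBox_iff hs (Nat.succ_pos t)] at h2
      simp only [IsArrow, Prod.mk.injEq]
      omega
    · rw [rectDiagram_eq_rectOfBox_iff hs ht] at h1
      rw [rectDiagram_eq_rectOfBox_iff (Nat.succ_pos s) (Nat.succ_pos t)] at h2
      simp only [IsArrow, Prod.mk.injEq]
      omega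
  · simp only [IsArrow, Prod.mk.injEq]
    rintro (⟨rfl, rfl⟩ | ⟨rfl, rfl⟩ | ⟨rfl, rfl⟩)
    · exact Or.inl ⟨r' + 1, c + 1, by omega, by omega, rfl, Or.inl rfl⟩
    · exact Or.inl ⟨r + 1, c' + 1, by omega, by omega, rfl, Or.inr rfl⟩
    · exact Or.inr ⟨r + 1, c + 1, by omega, by omega, rfl, rfl⟩

open Classical in
theorem mainTheorem10 {n k : ℕ} (hk : 0 < k) (hkn : k < n)
    (wK x w : Equiv.Perm (Fin n)) (hwK : IsLongestInParabolic k wK)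
    (hx : IsMinLeftCosetRep k x) (hw : w = x * wK)
    (hlen : permLength w = permLength x + permLength wK)
    (lam : YoungDiagram)
    (hlam : lam = diagramOfSteps ((initialSubset n k).map x.toEmbedding))
    (B : PlabicMap n) (hB : B = bridgeGraph k wK w) :
    -- the target labels are distinct, and are given by the rectangles in `lam` and by `[k]`
    Function.Injective B.targetLabel ∧
    (∀ S : Set (Fin n), S ∈ Set.range B.targetLabel ↔
      (∃ μ, IsNonemptyRect μ ∧ μ ≤ lam ∧ S = ↑(verticalSteps n k μ)) ∨
        S = ↑(initialSubset n k)) ∧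
    -- arrows between faces labeled by rectangles
    (∀ μ ν : YoungDiagram, IsNonemptyRect μ → IsNonemptyRect ν → μ ≤ lam → ν ≤ lam →
      ∀ F F' : B.Face, B.targetLabel F = ↑(verticalSteps n k μ) →
        B.targetLabel F' = ↑(verticalSteps n k ν) →
        B.dualQuiver.arrows F F' =
          if (RemovesRowOrColumn μ ν ∨ AddsHook μ ν) ∧
            ¬ (B.IsBoundaryFace F ∧ B.IsBoundaryFace F') then 1 else 0) ∧
    -- arrows between a face labeled by a rectangle and the face labeled by `[k]`
    (∀ μ : YoungDiagram, IsNonemptyRect μ → μ ≤ lam →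
      ∀ F F₀ : B.Face, B.targetLabel F = ↑(verticalSteps n k μ) →
        B.targetLabel F₀ = ↑(initialSubset n k) →
        B.dualQuiver.arrows F F₀ =
          (if μ = rectDiagram 1 1 ∧ ¬ (B.IsBoundaryFace F ∧ B.IsBoundaryFace F₀)
            then 1 else 0) ∧
        B.dualQuiver.arrows F₀ F = 0) ∧
    -- without the face labeled by `[k]`, this is the quiver of the rectangles seed
    (∀ v : Equiv.Perm (Fin n), IsMaxRightCosetRep k v →
      permLength (x * v) = permLength x + permLength v →
      ∃ e : IceQuiver.Iso (rectanglesQuiver k v (x * v))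
          (B.dualQuiver.restrict fun F => B.targetLabel F ≠ ↑(initialSubset n k)),
        ∀ b, B.targetLabel (e.toEquiv b).1 = ↑(verticalSteps n k (rectOfBox b.1))) := by
  have hbox : ∀ b ∈ lam, b.1 < k ∧ b.2 < n - k := fun b hb => mem_diagramOfSteps x (hlam ▸ hb)
  have hS : IsDiagramIn n k {b | b ∈ lam} :=
    ⟨hk, hkn, fun r c h => (hbox _ h).1, fun r c h => (hbox _ h).2,
      fun r c r' c' h hr hc => lam.isLowerSet (show (r, c) ≤ (r', c') from ⟨hr, hc⟩) h⟩
  obtain ⟨N⟩ : Nonempty (DartNaming B (Valid n k {b | b ∈ lam})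
      (BridgeDart.rv k {b | b ∈ lam}) (BridgeDart.rt {b | b ∈ lam})) := by
    rw [hB]
    exact DartNaming.bridgeGraph hk hkn wK w lam (by rw [hw, mul_inv_cancel_right, hlam]) hbox
  refine ⟨N.targetLabel_injective hS, ?_, ?_, ?_, ?_⟩
  · intro T
    constructor
    · rintro ⟨F, rfl⟩
      rcases hb : N.boxOfFace hS F with _ | b
      · exact Or.inr (N.targetLabel_of_none hS hb)
      · exact Or.inl ⟨rectOfBox b, isNonemptyRect_iff.2 ⟨b, rfl⟩,
          rectOfBox_le_iff.2 (N.boxOfFace_mem hS hb), N.targetLabel_of_some hS hb⟩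
    · rintro (⟨μ, hμ, hle, rfl⟩ | rfl)
      · obtain ⟨b, rfl⟩ := isNonemptyRect_iff.1 hμ
        obtain ⟨F, hF⟩ := N.exists_boxOfFace hS (b := b) (rectOfBox_le_iff.1 hle)
        exact ⟨F, N.targetLabel_of_some hS hF⟩
      · obtain ⟨F, hF⟩ := N.exists_boxOfFace_none hS
        exact ⟨F, N.targetLabel_of_none hS hF⟩
  · intro μ ν hμ hν hμl hνl F F' hF hF'
    obtain ⟨a, rfl⟩ := isNonemptyRect_iff.1 hμ
    obtain ⟨b, rfl⟩ := isNonemptyRect_iff.1 hν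
    rw [N.targetLabel_eq_rect_iff hS (b := a) (rectOfBox_le_iff.1 hμl)] at hF
    rw [N.targetLabel_eq_rect_iff hS (b := b) (rectOfBox_le_iff.1 hνl)] at hF'
    rw [N.arrows_some_some hS hF hF']
    exact if_congr (and_congr_left' isArrow_iff.symm) rfl rfl
  · intro μ hμ hμl F F₀ hF hF₀
    obtain ⟨a, rfl⟩ := isNonemptyRect_iff.1 hμ
    rw [N.targetLabel_eq_rect_iff hS (b := a) (rectOfBox_le_iff.1 hμl)] at hF
    rw [N.targetLabel_eq_initial_iff hS] at hF₀
    have h := N.arrows_some_none hS hF hF₀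
    refine ⟨h.1.trans (if_congr (and_congr_left' ?_) rfl rfl), h.2⟩
    exact rectOfBox_injective.eq_iff.symm
  · intro v _ _
    -- The quiver depends on `v` and `x * v` only through their quotient `x`, so it is the quiver on
    -- the boxes of `lam`.
    have hq : diagramOfSteps ((initialSubset n k).map (x * v * v⁻¹).toEmbedding) = lam := by
      rw [mul_inv_cancel_right, hlam]
    unfold rectanglesQuiver
    rw [hq]
    choose f hf using fun b : {b // b ∈ lam} => N.exists_boxOfFace hS (b := b.1) b.2
    let g : {b // b ∈ lam} → {F : B.Face // B.targetLabel F ≠ ↑(initialSubset n k)} := fun b =>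
      ⟨f b, by rw [Ne, N.targetLabel_eq_initial_iff hS, hf]; simp⟩
    have hg : Function.Bijective g := by
      constructor
      · intro a b h
        have h' : f a = f b := congrArg Subtype.val h
        have := hf a
        rw [h', hf b] at this
        exact (Subtype.ext (Option.some.inj this)).symm
      · rintro ⟨F, hF⟩
        rw [Ne, N.targetLabel_eq_initial_iff hS] at hF
        obtain ⟨b, hb⟩ := Option.ne_none_iff_exists'.1 hF
        exact ⟨⟨b, N.boxOfFace_mem hS hb⟩, Subtype.ext (N.boxOfFace_injective hS (by
          rw [hb]; exact hf _))⟩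
    have hfr : ∀ b, B.IsBoundaryFace (f b) ↔ IsFrozenBox lam b.1 := by
      intro b
      rw [N.isBoundaryFace_iff hS, hf]
      refine ⟨fun h => h _ _ rfl, fun h r c e => ?_⟩
      rw [Option.some.inj e] at h
      exact h
    refine ⟨⟨Equiv.ofBijective g hg, hfr, ?_⟩, fun b => N.targetLabel_of_some hS (hf b)⟩
    intro a b
    change B.dualQuiver.arrows (f a) (f b) = _
    rw [N.arrows_some_some hS (hf a) (hf b)]
    exact if_congr (and_congr_right' (not_congr (and_congr (hfr a) (hfr b)))) rfl rfl
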